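/- Conventions. Let $\mathcal{L}$ be a finite lattice with minimal element $0$ and maximal element $1$, and let $\mathcal{D}$ be a triangulated category. For a full subcategory $\mathcal{E}\subset\mathcal{D}$ put $\mathcal{E}^\perp=\{D : \mathrm{Hom}(\mathcal{E},D)=0\}$ and ${}^\perp\mathcal{E}=\{D : \mathrm{Hom}(D,\mathcal{E})=0\}$. An \emph{admissible $\mathcal{L}$-filtration} on $\mathcal{D}$ is an order-preserving map $I\mapsto\mathcal{D}_I$ from $\mathcal{L}$ to the (strictly full) triangulated subcategories of $\mathcal{D}$ whose inclusion functor has both a left and a right adjoint, such that $\mathcal{D}_0=0$, $\mathcal{D}_1=\mathcal{D}$ and, for all $I,J\in\mathcal{L}$, $$\mathcal{D}_{I\wedge J}=\mathcal{D}_I\cap\mathcal{D}_J,\qquad \mathcal{D}_{I\vee J}^\perp=\mathcal{D}_I^\perp\cap\mathcal{D}_J^\perp,\qquad {}^\perp\mathcal{D}_{I\vee J}={}^\perp\mathcal{D}_I\cap{}^\perp\mathcal{D}_J .$$ For $I\preceq J$ let $\mathcal{D}_{[I,J]}:=\mathcal{D}_J/\mathcal{D}_I$ be the Verdier quotient. The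 filtration is \emph{strict} if for all $I,J\in\mathcal{L}$ every morphism in $\mathcal{D}_{I\vee J}/\mathcal{D}_{I\wedge J}$ from an object of $\mathcal{D}_I/\mathcal{D}_{I\wedge J}$ to an object of $\mathcal{D}_J/\mathcal{D}_{I\wedge J}$ is zero. A \emph{recollement} consists of exact functors $i_*\colon\mathcal{D}_0\to\mathcal{D}$ and $j^*\colon\mathcal{D}\to\mathcal{D}_1$ of triangulated categories with adjunctions $i^*\dashv i_*\dashv i^!$ and $j_!\dashv j^*\dashv j_*$ such that $i_*,j_!,j_*$ are fully faithful and the kernel of $j^*$ is the essential image of $i_*$. Given $t$-structures on $\mathcal{D}_0$ and $\mathcal{D}_1$, the \emph{glued} $t$-structure on $\mathcal{D}$ is $$\mathcal{D}^{\le 0}=\{X : i^*X\in\mathcal{D}_0^{\le 0},\ j^*X\in\mathcal{D}_1^{\le 0}\},\qquad \mathcal{D}^{\ge 1}=\{X : i^!X\in\mathcal{D}_0^{\ge 1},\ j^*X\in\mathcal{D}_1^{\ge 1}\}.$$ An element $s\neq 0$ of $\mathcal{L}$ is \emph{join-prime} if $s\preceq J_1\vee J_2$ implies $s\preceq J_1$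 or $s\preceq J_2$. For a join-prime $s$ let $s_<$ be the join of all join-prime elements strictly below $s$, and put $\mathcal{D}^o_s:=\mathcal{D}_{[s_<,s]}=\mathcal{D}_s/\mathcal{D}_{s_<}$. \textbf{Theorem.} Let $\mathcal{L}$ be a finite distributive lattice and $\mathcal{D}$ a triangulated category with a strict admissible $\mathcal{L}$-filtration. Given a $t$-structure on $\mathcal{D}^o_s$ for every join-prime $s\in\mathcal{L}$, there exists a unique system of $t$-structures on the categories $\mathcal{D}_{[J,L]}$, one for every pair $J\preceq L$ in $\mathcal{L}$, such that \begin{itemize} \item for every join-prime $s$, the $t$-structure on $\mathcal{D}_{[s_<,s]}=\mathcal{D}^o_s$ is the given one; \item for all $J\preceq K\preceq L$ in $\mathcal{L}$, the functors $i_*\colon\mathcal{D}_{[J,K]}\to\mathcal{D}_{[J,L]}$ (induced by the inclusion $\mathcal{D}_K\subset\mathcal{D}_L$) and $j^*\colon\mathcal{D}_{[J,L]}\to\mathcal{D}_{[K,L]}$ (the quotient functor) form a recollement, and the $t$-structure on $\mathcal{D}_{[J,L]}$ is glued via this recollement from the $t$-structures on $\mathcal{D}_{[J,K]}$ and $\mathcal{D}_{[K,L]}$.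 \end{itemize} -/

import Mathlib

open CategoryTheory CategoryTheory.Limits CategoryTheory.Pretriangulated
  CategoryTheory.Triangulated

universe v v₀ v₁ u u₀ u₁ w

/-- An admissible `L`-filtration on a triangulated category `C`, for a bounded lattice `L`
(every nonempty finite lattice is bounded): to each `I : L` is attached a (strictly full)
triangulated subcategory `C_I` of `C`, monotonically in `I`, which is left and right admissible,
such that
* `C_⊥ = 0` and `C_⊤ = C`,
* `C_{I ⊓ J} = C_I ∩ C_J`,
* `(C_{I ⊔ J})^⊥ = C_I^⊥ ∩ C_J^⊥` and `^⊥(C_{I ⊔ J}) = ^⊥C_I ∩ ^⊥C_J`. -/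
structure AdmissibleFiltration (L : Type w) [Lattice L] [BoundedOrder L]
    (C : Type u) [Category.{v} C] [Preadditive C] [HasZeroObject C] [HasShift C ℤ]
    [∀ n : ℤ, (shiftFunctor C n).Additive] [Pretriangulated C] where
  /-- the subcategory `C_I` -/
  obj : L → ObjectProperty C
  isTriangulated (I : L) : (obj I).IsTriangulated
  isClosedUnderIsomorphisms (I : L) : (obj I).IsClosedUnderIsomorphisms
  monotone : Monotone obj
  /-- the inclusion of `C_I` has a left adjoint -/
  leftAdmissible (I : L) : (obj I).ι.IsRightAdjoint
  /-- the inclusion of `C_I` has a right adjoint -/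
  rightAdmissible (I : L) : (obj I).ι.IsLeftAdjoint
  obj_bot : obj ⊥ = fun X => IsZero X
  obj_top : obj ⊤ = ⊤
  obj_inf (I J : L) : obj (I ⊓ J) = obj I ⊓ obj J
  rightOrthogonal_sup (I J : L) :
    (obj (I ⊔ J)).rightOrthogonal = (obj I).rightOrthogonal ⊓ (obj J).rightOrthogonal
  leftOrthogonal_sup (I J : L) :
    (obj (I ⊔ J)).leftOrthogonal = (obj I).leftOrthogonal ⊓ (obj J).leftOrthogonal

namespace AdmissibleFiltration

attribute [instance] AdmissibleFiltration.isTriangulated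
  AdmissibleFiltration.isClosedUnderIsomorphisms

section

variable {L : Type w} [Lattice L] [BoundedOrder L]
  {C : Type u} [Category.{v} C] [Preadditive C] [HasZeroObject C] [HasShift C ℤ]
  [∀ n : ℤ, (shiftFunctor C n).Additive] [Pretriangulated C]
  (F : AdmissibleFiltration L C)

/-- For `I ≤ J`, the subcategory `C_I`, regarded as a full subcategory of `C_J`. -/
abbrev sub (I J : L) : ObjectProperty (F.obj J).FullSubcategory :=
  (F.obj I).inverseImage (F.obj J).ι

/-- For `I ≤ J`, the Verdier quotient `C_{[I, J]} = C_J / C_I`, i.e. the localization of `C_J`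
with respect to the morphisms whose cone belongs to `C_I`. -/
abbrev Subquotient (I J : L) : Type u := (F.sub I J).trW.Localization

/-- The quotient functor `C_J ⥤ C_J / C_I`. -/
abbrev quotientFunctor (I J : L) : (F.obj J).FullSubcategory ⥤ F.Subquotient I J :=
  (F.sub I J).trW.Q

/-- For `J ≤ J'`, the inclusion functor `C_J ⥤ C_{J'}`. -/
abbrev inclusion {J J' : L} (hJ : J ≤ J') :
    (F.obj J).FullSubcategory ⥤ (F.obj J').FullSubcategory :=
  (F.obj J').lift (F.obj J).ι (fun X => F.monotone hJ _ X.property)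

/-- For `I ≤ I'` and `J ≤ J'`, the inclusion `C_J ⥤ C_{J'}` sends the morphisms with cone in `C_I`
to morphisms with cone in `C_{I'}`. -/
def localizerMorphism {I I' J J' : L} (hI : I ≤ I') (hJ : J ≤ J') :
    LocalizerMorphism (F.sub I J).trW (F.sub I' J').trW where
  functor := F.inclusion hJ
  map X Y f hf := by
    rw [MorphismProperty.inverseImage_iff, ObjectProperty.inverseImage_trW_iff]
    rw [ObjectProperty.inverseImage_trW_iff] at hf
    exact ObjectProperty.trW_monotone (F.monotone hI) _ hf

noncomputable instance {I I' J J' : L} (hI : I ≤ I') (hJ : J ≤ J') :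
    (F.localizerMorphism hI hJ).functor.CommShift ℤ :=
  inferInstanceAs ((F.inclusion hJ).CommShift ℤ)

variable [IsTriangulated C]

/-- For `I ≤ I'` and `J ≤ J'`, the functor `C_J / C_I ⥤ C_{J'} / C_{I'}` induced by the inclusion of
`C_J` into `C_{J'}`. For `I = I'` this is the inclusion `C_{[I, J]} ⥤ C_{[I, J']}`, and
for `J = J'` it is the quotient functor `C_{[I, J]} ⥤ C_{[I', J]}`. -/
noncomputable abbrev map {I I' J J' : L} (hI : I ≤ I') (hJ : J ≤ J') :
    F.Subquotient I J ⥤ F.Subquotient I' J' :=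
  (F.localizerMorphism hI hJ).localizedFunctor (F.quotientFunctor I J) (F.quotientFunctor I' J')

/-- The filtration is strict if, for all `I` and `J`, there is no nonzero morphism from an object
of `C_I / C_{I ⊓ J}` to an object of `C_J / C_{I ⊓ J}` in `C_{I ⊔ J} / C_{I ⊓ J}`. -/
def IsStrict : Prop :=
  ∀ (I J : L) (X Y : (F.obj (I ⊔ J)).FullSubcategory), F.obj I X.obj → F.obj J Y.obj →
    ∀ f : (F.quotientFunctor (I ⊓ J) (I ⊔ J)).obj X ⟶ (F.quotientFunctor (I ⊓ J) (I ⊔ J)).obj Y,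
      f = 0

end

end AdmissibleFiltration

/-- For an element `s` of a finite lattice, the join of all join-prime elements strictly below `s`.
In a finite distributive lattice, viewed as the lattice of lower ideals in its poset of join-prime
elements, it is the lower ideal of all join-primes strictly below `s`. -/
noncomputable def strictLower {L : Type w} [Lattice L] [BoundedOrder L] [Finite L] (s : L) : L :=
  (Set.toFinite {r : L | SupPrime r ∧ r < s}).toFinset.sup id

theorem strictLower_le {L : Type w} [Lattice L] [BoundedOrder L] [Finite L] (s : L) :
    strictLower s ≤ s :=
  Finset.sup_le fun r hr => by
    have h : SupPrime r ∧ r < s := by simpa using hr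
    exact h.2.le

section

variable {C₀ : Type u₀} [Category.{v₀} C₀] [Preadditive C₀] [HasZeroObject C₀] [HasShift C₀ ℤ]
  [∀ n : ℤ, (shiftFunctor C₀ n).Additive] [Pretriangulated C₀]
  {C : Type u} [Category.{v} C] [Preadditive C] [HasZeroObject C] [HasShift C ℤ]
  [∀ n : ℤ, (shiftFunctor C n).Additive] [Pretriangulated C]
  {C₁ : Type u₁} [Category.{v₁} C₁] [Preadditive C₁] [HasZeroObject C₁] [HasShift C₁ ℤ]
  [∀ n : ℤ, (shiftFunctor C₁ n).Additive] [Pretriangulated C₁]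

/-- The exact functors `i = i_* : C₀ ⥤ C` and `j = j^* : C ⥤ C₁` are part of a recollement:
there are adjunctions `i^* ⊣ i_* ⊣ i^!` and `j_! ⊣ j^* ⊣ j_*`, the functors `i_*`, `j_!`, `j_*`
are fully faithful, and the kernel of `j^*` is the essential image of `i_*`.
(The adjoints are unique up to isomorphism and automatically exact.) -/
structure IsRecollement (i : C₀ ⥤ C) (j : C ⥤ C₁) [i.CommShift ℤ] [j.CommShift ℤ] : Prop where
  isTriangulated_i : i.IsTriangulated
  isTriangulated_j : j.IsTriangulated
  full_i : i.Full
  faithful_i : i.Faithful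
  exists_leftAdjoint_i : ∃ iL : C ⥤ C₀, Nonempty (iL ⊣ i)
  exists_rightAdjoint_i : ∃ iR : C ⥤ C₀, Nonempty (i ⊣ iR)
  exists_leftAdjoint_j : ∃ jL : C₁ ⥤ C, Nonempty (jL ⊣ j) ∧ jL.Full ∧ jL.Faithful
  exists_rightAdjoint_j : ∃ jR : C₁ ⥤ C, Nonempty (j ⊣ jR) ∧ jR.Full ∧ jR.Faithful
  isZero_obj_iff (X : C) : IsZero (j.obj X) ↔ i.essImage X

/-- The functors `i = i_*` and `j = j^*` are part of a recollement, and the t-structure `t` on `C`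
is glued via this recollement from the t-structures `t₀` on `C₀` and `t₁` on `C₁`:
`C^{≤ 0} = {X | i^* X ∈ C₀^{≤ 0}, j^* X ∈ C₁^{≤ 0}}` and
`C^{≥ 1} = {X | i^! X ∈ C₀^{≥ 1}, j^* X ∈ C₁^{≥ 1}}`. -/
structure IsGlued (i : C₀ ⥤ C) (j : C ⥤ C₁) [i.CommShift ℤ] [j.CommShift ℤ]
    (t₀ : TStructure C₀) (t : TStructure C) (t₁ : TStructure C₁) : Prop
    extends IsRecollement i j where
  le_iff (iL : C ⥤ C₀) (_ : iL ⊣ i) (X : C) :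
    t.le 0 X ↔ t₀.le 0 (iL.obj X) ∧ t₁.le 0 (j.obj X)
  ge_iff (iR : C ⥤ C₀) (_ : i ⊣ iR) (X : C) :
    t.ge 1 X ↔ t₀.ge 1 (iR.obj X) ∧ t₁.ge 1 (j.obj X)

end

/-! ### Generalities on distinguished triangles and t-structures. -/

section

variable {C : Type u} [Category.{v} C] [Preadditive C] [HasZeroObject C] [HasShift C ℤ]
  [∀ n : ℤ, (shiftFunctor C n).Additive] [Pretriangulated C]

/-! By distributivity, an element of `L` is determined by the join-primes below it, so `J ≤ M` can
be joined by a chain adding one join-prime at a time; the steps have subquotients equivalent to the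
`C_s / C_{s_<}`, and t-structures are glued along the chain.

Strictness makes this possible. It forces the reflection `lam A` and the coreflection `rho A` to
carry `C_J` into `C_{A ⊓ J}` (`IsStrict.lam_mem`, `IsStrict.rho_mem`), so both descend to functors
`C_M / C_J ⥤ C_A / C_{A ⊓ J}` adjoint to the natural functor back. Together with
`IsStrict.mem_of_leftOrthogonal` this gives a recollement of `C_M / C_J` from `C_A / C_{A ⊓ J}` and
`C_M / C_{A ⊔ J}` (`IsStrict.isRecollement`). Meet and join enter it as equations, so that it covers
both `A = s` with `s ⊓ J = s_<` and the nested case `J ≤ A`.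

For existence, the glued t-structure admits a description independent of the chain
(`IsStrict.exists_tStructure`): `X` is in `≤ n` iff `lam s X` is so in `C_s / C_{s_<}` for every
join-prime `s ≤ M` with `¬ s ≤ J`, and dually with `rho`. Compatibility with every recollement `J ≤
K ≤ M` then reduces to `lam s ∘ lam K ≅ lam s` for `s ≤ K`. For uniqueness,
`IsStrict.tStructure_sup_eq` transports the given t-structure to `C_{s ⊔ J} / C_J`, and the same
induction applies. -/

/-- The first objects of two distinguished triangles are isomorphic when the second morphisms are
isomorphic as arrows. -/
lemma nonempty_iso₁_of_distTriang {X Y Z X' Y' Z' : C} {f : X ⟶ Y} {g : Y ⟶ Z} {h : Z ⟶ X⟦(1 : ℤ)⟧}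
    (hT : Triangle.mk f g h ∈ distTriang C) {f' : X' ⟶ Y'} {g' : Y' ⟶ Z'} {h' : Z' ⟶ X'⟦(1 : ℤ)⟧}
    (hT' : Triangle.mk f' g' h' ∈ distTriang C) (e₂ : Y ≅ Y') (e₃ : Z ≅ Z')
    (comm : g ≫ e₃.hom = e₂.hom ≫ g') : Nonempty (X ≅ X') := by
  obtain ⟨a, h₁, h₂⟩ := complete_distinguished_triangle_morphism₁ _ _ hT hT' e₂.hom e₃.hom comm
  let φ := Triangle.homMk (Triangle.mk f g h) (Triangle.mk f' g' h') a e₂.hom e₃.hom h₁ comm h₂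
  have := isIso₁_of_isIso₂₃ φ hT hT'
    (inferInstanceAs (IsIso e₂.hom)) (inferInstanceAs (IsIso e₃.hom))
  exact ⟨@asIso _ _ _ _ φ.hom₁ this⟩

namespace CategoryTheory.Triangulated.TStructure

lemma ext_of_le_of_ge {t t' : TStructure C} (hle : ∀ X, t.le 0 X ↔ t'.le 0 X)
    (hge : ∀ X, t.ge 1 X ↔ t'.ge 1 X) : t = t' := by
  have h₁ : t.le = t'.le := by
    funext n
    rw [← t.shift_le n 0 n (by simp), ← t'.shift_le n 0 n (by simp)]
    ext X
    exact hle _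
  have h₂ : t.ge = t'.ge := by
    funext n
    rw [← t.shift_ge (n - 1) 1 n (by simp), ← t'.shift_ge (n - 1) 1 n (by simp)]
    ext X
    exact hge _
  cases t
  cases t'
  congr

/-- The t-structure on a category in which all objects are zero. -/
def ofIsZero (h : ∀ X : C, IsZero X) : TStructure C where
  le _ := ⊤
  ge _ := ⊤
  le_shift := by simp
  ge_shift := by simp
  zero' X Y f _ _ := (h X).eq_of_src _ _
  le_zero_le := le_rfl
  ge_one_le := le_rfl
  exists_triangle_zero_one A := ⟨A, _, trivial, trivial, 𝟙 A, 0, 0, contractible_distinguished A⟩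

end CategoryTheory.Triangulated.TStructure

end

/-! ### Gluing t-structures along a recollement. -/

section

variable {C₀ : Type u₀} [Category.{v₀} C₀] [Preadditive C₀] [HasZeroObject C₀] [HasShift C₀ ℤ]
  [∀ n : ℤ, (shiftFunctor C₀ n).Additive] [Pretriangulated C₀]
  {C : Type u} [Category.{v} C] [Preadditive C] [HasZeroObject C] [HasShift C ℤ]
  [∀ n : ℤ, (shiftFunctor C n).Additive] [Pretriangulated C]
  {C₁ : Type u₁} [Category.{v₁} C₁] [Preadditive C₁] [HasZeroObject C₁] [HasShift C₁ ℤ]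
  [∀ n : ℤ, (shiftFunctor C₁ n).Additive] [Pretriangulated C₁]

/-- A fully faithful functor which preserves `≤ 0` and `≥ 1` also reflects `≤ 0`. -/
lemma CategoryTheory.Triangulated.TStructure.le_zero_obj_iff (e : C₀ ⥤ C) [e.Faithful]
    (t₀ : TStructure C₀) (t : TStructure C) [e.CommShift ℤ] [e.IsTriangulated]
    (hle : ∀ X, t₀.le 0 X → t.le 0 (e.obj X)) (hge : ∀ X, t₀.ge 1 X → t.ge 1 (e.obj X)) (X : C₀) :
    t.le 0 (e.obj X) ↔ t₀.le 0 X := by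
  refine ⟨fun h ↦ ?_, hle X⟩
  rw [t₀.le_iff_isLE, t₀.isLE_iff_orthogonal 0 1 (by simp)]
  intro Y f hY
  apply e.map_injective
  rw [e.map_zero]
  exact t.zero' _ h (hge Y hY.ge)

/-- Dual argument: `≥ 1` is the right orthogonal of `≤ 0`, and a faithful functor detects the
vanishing of morphisms. -/
lemma CategoryTheory.Triangulated.TStructure.ge_one_obj_iff (e : C₀ ⥤ C) [e.Faithful]
    (t₀ : TStructure C₀) (t : TStructure C) [e.CommShift ℤ] [e.IsTriangulated]
    (hle : ∀ X, t₀.le 0 X → t.le 0 (e.obj X)) (hge : ∀ X, t₀.ge 1 X → t.ge 1 (e.obj X)) (X : C₀) :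
    t.ge 1 (e.obj X) ↔ t₀.ge 1 X := by
  refine ⟨fun h ↦ ?_, hge X⟩
  rw [t₀.ge_iff_isGE, t₀.isGE_iff_orthogonal 0 1 (by simp)]
  intro Y f hY
  apply e.map_injective
  rw [e.map_zero]
  exact t.zero' _ (hle Y hY.le) h

namespace IsRecollement

variable {i : C₀ ⥤ C} {j : C ⥤ C₁} [i.CommShift ℤ] [j.CommShift ℤ]

lemma isZero_j_obj_i_obj (h : IsRecollement i j) (X : C₀) : IsZero (j.obj (i.obj X)) :=
  (h.isZero_obj_iff _).2 (i.obj_mem_essImage X)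

/-- The composite `i^! j_*` is right adjoint to `j^* i_* = 0`. -/
lemma isZero_rightAdjoint_obj (h : IsRecollement i j) {iR : C ⥤ C₀} (adjR : i ⊣ iR)
    {jR : C₁ ⥤ C} (adj : j ⊣ jR) (B : C₁) : IsZero (iR.obj (jR.obj B)) := by
  rw [IsZero.iff_id_eq_zero]
  apply (adjR.homEquiv _ _).symm.injective
  apply (adj.homEquiv _ _).symm.injective
  exact (h.isZero_j_obj_i_obj _).eq_of_src _ _

/-- Gluing of t-structures along a recollement. -/
theorem exists_tStructure [IsTriangulated C] (h : IsRecollement i j)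
    (t₀ : TStructure C₀) (t₁ : TStructure C₁)
    {iL iR : C ⥤ C₀} (adjL : iL ⊣ i) (adjR : i ⊣ iR) :
    ∃ t : TStructure C, ∀ (n : ℤ) (X : C),
      (t.le n X ↔ t₀.le n (iL.obj X) ∧ t₁.le n (j.obj X)) ∧
      (t.ge n X ↔ t₀.ge n (iR.obj X) ∧ t₁.ge n (j.obj X)) := by
  have := h.isTriangulated_i
  have := h.isTriangulated_j
  have := h.full_i
  have := h.faithful_i
  obtain ⟨jR, ⟨adj⟩, _, _⟩ := h.exists_rightAdjoint_j
  let := adjL.leftAdjointCommShift ℤ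
  have := adjL.commShift_of_rightAdjoint ℤ
  have := adjL.isTriangulated_leftAdjoint
  let := adjR.rightAdjointCommShift ℤ
  have := adjR.commShift_of_leftAdjoint ℤ
  have := adjR.isTriangulated_rightAdjoint
  refine ⟨{
    le n := fun X ↦ t₀.le n (iL.obj X) ∧ t₁.le n (j.obj X)
    ge n := fun X ↦ t₀.ge n (iR.obj X) ∧ t₁.ge n (j.obj X)
    le_isClosedUnderIsomorphisms n := ⟨fun e hX ↦
      ⟨(t₀.le n).prop_of_iso (iL.mapIso e) hX.1, (t₁.le n).prop_of_iso (j.mapIso e) hX.2⟩⟩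
    ge_isClosedUnderIsomorphisms n := ⟨fun e hX ↦
      ⟨(t₀.ge n).prop_of_iso (iR.mapIso e) hX.1, (t₁.ge n).prop_of_iso (j.mapIso e) hX.2⟩⟩
    le_shift n a n' ha X hX :=
      ⟨(t₀.le n').prop_of_iso ((iL.commShiftIso a).symm.app X) (t₀.le_shift n a n' ha _ hX.1),
        (t₁.le n').prop_of_iso ((j.commShiftIso a).symm.app X) (t₁.le_shift n a n' ha _ hX.2)⟩
    ge_shift n a n' ha X hX :=
      ⟨(t₀.ge n').prop_of_iso ((iR.commShiftIso a).symm.app X) (t₀.ge_shift n a n' ha _ hX.1),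
        (t₁.ge n').prop_of_iso ((j.commShiftIso a).symm.app X) (t₁.ge_shift n a n' ha _ hX.2)⟩
    zero' := ?_
    le_zero_le X hX := ⟨t₀.le_zero_le _ hX.1, t₁.le_zero_le _ hX.2⟩
    ge_one_le X hX := ⟨t₀.ge_one_le _ hX.1, t₁.ge_one_le _ hX.2⟩
    exists_triangle_zero_one := ?_ }, fun n X ↦ ⟨Iff.rfl, Iff.rfl⟩⟩
  -- Orthogonality: the fibre `W` of `Y ⟶ j_* j^* Y` comes from some `W'` in `C₀`, and `W' ≅ i^! Y`
  -- because `i^! j_* = 0`. The part of `f` in `j_* j^* Y` vanishes by `t₁`, and the resulting lift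
  -- of `f` to `W` vanishes by `t₀`.
  · intro X Y f hX hY
    let η : Y ⟶ jR.obj (j.obj Y) := adj.unit.app Y
    have hη : IsIso (j.map η) :=
      have : IsIso (adj.counit.app (j.obj Y)) := inferInstance
      IsIso.of_isIso_fac_right (adj.left_triangle_components Y)
    obtain ⟨W, a, b, hT⟩ := distinguished_cocone_triangle₁ η
    have hW : IsZero (j.obj W) := Triangle.isZero₁_of_isIso₂ _ (j.map_distinguished _ hT) hη
    obtain ⟨W', ⟨e⟩⟩ := (h.isZero_obj_iff W).1 hW
    have ha : IsIso (iR.map a) :=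
      (Triangle.isZero₃_iff_isIso₁ _ (iR.map_distinguished _ hT)).1
        (h.isZero_rightAdjoint_obj adjR adj _)
    have hW' : t₀.ge 1 W' := (t₀.ge 1).prop_of_iso
      ((asIso (adjR.unit.app W') : W' ≅ iR.obj (i.obj W')) ≪≫ iR.mapIso e ≪≫
        asIso (iR.map a)).symm hY.1
    have hf : f ≫ η = 0 := by
      have : f ≫ η = adj.homEquiv _ _ (j.map f) := by simp [Adjunction.homEquiv_unit, η]
      rw [this, t₁.zero' (j.map f) hX.2 hY.2]
      have : jR.Additive := adj.right_adjoint_additive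
      simp [Adjunction.homEquiv_unit]
    obtain ⟨g, hg⟩ : ∃ g : X ⟶ W, f = g ≫ a := Triangle.coyoneda_exact₂ _ hT f hf
    have hg' : g ≫ e.inv = 0 := by
      apply (adjL.homEquiv _ _).symm.injective
      rw [t₀.zero' ((adjL.homEquiv X W').symm (g ≫ e.inv)) hX.1 hW']
      simp [Adjunction.homEquiv_counit]
    rw [hg, (cancel_mono e.inv).1 (hg'.trans zero_comp.symm), zero_comp]
  -- Truncation is done twice: `Y` is the fibre of `X ⟶ j_* τ^{≥ 1} j^* X`, then `A` is the fibre of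
  -- `Y ⟶ i_* τ^{≥ 1} i^* Y`. The octahedron presents the cone `B` of `A ⟶ X` as an extension of
  -- `j_* B₁` by `i_* B₀`.
  · intro X
    obtain ⟨A₁, B₁, hA₁, hB₁, f₁, g₁, k₁, hT₁⟩ := t₁.exists_triangle_zero_one (j.obj X)
    obtain ⟨Y, a, b, hTY⟩ := distinguished_cocone_triangle₁ (adj.homEquiv _ _ g₁)
    obtain ⟨A₀, B₀, hA₀, hB₀, f₀, g₀, k₀, hT₀⟩ := t₀.exists_triangle_zero_one (iL.obj Y)
    obtain ⟨A, a', b', hTA⟩ := distinguished_cocone_triangle₁ (adjL.homEquiv _ _ g₀)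
    obtain ⟨B, c, d, hTB⟩ := distinguished_cocone_triangle (a' ≫ a)
    let o := someOctahedron rfl hTA hTY hTB
    let e₀ : iL.obj (i.obj B₀) ≅ B₀ := asIso (adjL.counit.app B₀)
    let e₁ : j.obj (jR.obj B₁) ≅ B₁ := asIso (adj.counit.app B₁)
    refine ⟨A, B, ⟨?_, ?_⟩, ⟨?_, ?_⟩, _, _, _, hTB⟩
    · obtain ⟨e⟩ := nonempty_iso₁_of_distTriang (iL.map_distinguished _ hTA) hT₀
        (Iso.refl _) e₀ (by
          have := (adjL.homEquiv Y B₀).symm_apply_apply g₀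
          rw [Adjunction.homEquiv_counit] at this
          exact this.trans (Category.id_comp _).symm)
      exact (t₀.le 0).prop_of_iso e.symm hA₀
    · have h₁ : IsIso (j.map a') :=
        (Triangle.isZero₃_iff_isIso₁ _ (j.map_distinguished _ hTA)).1 (h.isZero_j_obj_i_obj _)
      obtain ⟨e⟩ := nonempty_iso₁_of_distTriang (j.map_distinguished _ hTY) hT₁
        (Iso.refl _) e₁ (by
          have := (adj.homEquiv X B₁).symm_apply_apply g₁
          rw [Adjunction.homEquiv_counit] at this
          exact this.trans (Category.id_comp _).symm)
      exact (t₁.le 0).prop_of_iso (asIso (j.map a') ≪≫ e).symm hA₁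
    · have : IsIso (iR.map o.m₁) :=
        (Triangle.isZero₃_iff_isIso₁ _ (iR.map_distinguished _ o.mem)).1
          (h.isZero_rightAdjoint_obj adjR adj _)
      exact (t₀.ge 1).prop_of_iso ((asIso (adjR.unit.app B₀) : B₀ ≅ iR.obj (i.obj B₀)) ≪≫
        asIso (iR.map o.m₁)) hB₀
    · have : IsIso (j.map o.m₃) :=
        (Triangle.isZero₁_iff_isIso₂ _ (j.map_distinguished _ o.mem)).1 (h.isZero_j_obj_i_obj _)
      exact (t₁.ge 1).prop_of_iso (asIso (j.map o.m₃) ≪≫ e₁).symm hB₁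

end IsRecollement

end

/-! ### Exactness properties and uniqueness of the glued t-structure. -/

section

variable {C₀ : Type u₀} [Category.{v₀} C₀] [Preadditive C₀] [HasZeroObject C₀] [HasShift C₀ ℤ]
  [∀ n : ℤ, (shiftFunctor C₀ n).Additive] [Pretriangulated C₀]
  {C : Type u} [Category.{v} C] [Preadditive C] [HasZeroObject C] [HasShift C ℤ]
  [∀ n : ℤ, (shiftFunctor C n).Additive] [Pretriangulated C]
  {C₁ : Type u₁} [Category.{v₁} C₁] [Preadditive C₁] [HasZeroObject C₁] [HasShift C₁ ℤ]
  [∀ n : ℤ, (shiftFunctor C₁ n).Additive] [Pretriangulated C₁]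
  {i : C₀ ⥤ C} {j : C ⥤ C₁} [i.CommShift ℤ] [j.CommShift ℤ]
  {t₀ : TStructure C₀} {t : TStructure C} {t₁ : TStructure C₁}

namespace IsGlued

lemma le_zero_i_obj (h : IsGlued i j t₀ t t₁) {X : C₀} (hX : t₀.le 0 X) : t.le 0 (i.obj X) := by
  obtain ⟨iL, ⟨adj⟩⟩ := h.exists_leftAdjoint_i
  have := h.full_i
  have := h.faithful_i
  rw [h.le_iff iL adj]
  exact ⟨(t₀.le 0).prop_of_iso
    (asIso (adj.counit.app X) : iL.obj (i.obj X) ≅ X).symm hX,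
    (t₁.isLE_of_isZero (h.isZero_j_obj_i_obj X) 0).le⟩

lemma ge_one_i_obj (h : IsGlued i j t₀ t t₁) {X : C₀} (hX : t₀.ge 1 X) : t.ge 1 (i.obj X) := by
  obtain ⟨iR, ⟨adj⟩⟩ := h.exists_rightAdjoint_i
  have := h.full_i
  have := h.faithful_i
  rw [h.ge_iff iR adj]
  exact ⟨(t₀.ge 1).prop_of_iso
    (asIso (adj.unit.app X) : X ≅ iR.obj (i.obj X)) hX,
    (t₁.isGE_of_isZero (h.isZero_j_obj_i_obj X) 1).ge⟩

lemma le_zero_j_obj (h : IsGlued i j t₀ t t₁) {X : C} (hX : t.le 0 X) : t₁.le 0 (j.obj X) := by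
  obtain ⟨iL, ⟨adj⟩⟩ := h.exists_leftAdjoint_i
  exact ((h.le_iff iL adj X).1 hX).2

lemma ge_one_j_obj (h : IsGlued i j t₀ t t₁) {X : C} (hX : t.ge 1 X) : t₁.ge 1 (j.obj X) := by
  obtain ⟨iR, ⟨adj⟩⟩ := h.exists_rightAdjoint_i
  exact ((h.ge_iff iR adj X).1 hX).2

/-- The glued t-structure is determined by the t-structures it is glued from. -/
lemma unique (h : IsGlued i j t₀ t t₁) {t' : TStructure C} (h' : IsGlued i j t₀ t' t₁) :
    t = t' := by
  obtain ⟨iL, ⟨adjL⟩⟩ := h.exists_leftAdjoint_i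
  obtain ⟨iR, ⟨adjR⟩⟩ := h.exists_rightAdjoint_i
  exact TStructure.ext_of_le_of_ge
    (fun X ↦ (h.le_iff iL adjL X).trans (h'.le_iff iL adjL X).symm)
    (fun X ↦ (h.ge_iff iR adjR X).trans (h'.ge_iff iR adjR X).symm)

end IsGlued

end

/-! ### Orthogonality of the (co)fibres of (co)reflections. -/

section

variable {C : Type u} [Category.{v} C] [Preadditive C] [HasZeroObject C] [HasShift C ℤ]
  [∀ n : ℤ, (shiftFunctor C n).Additive] [Pretriangulated C]
  (P : ObjectProperty C) [P.IsTriangulated]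

/-- The fibre of the unit `X ⟶ L X` of the reflection onto a triangulated subcategory is left
orthogonal to this subcategory. -/
lemma leftOrthogonal_of_distTriang_unit {L : C ⥤ P.FullSubcategory} (adj : L ⊣ P.ι) {X W : C}
    {u : W ⟶ X} {w : (L.obj X).obj ⟶ W⟦(1 : ℤ)⟧}
    (hT : Triangle.mk u (adj.unit.app X : X ⟶ (L.obj X).obj) w ∈ distTriang C) :
    P.leftOrthogonal W := by
  have hfac : ∀ {Z : C} (_ : P Z) (g : X ⟶ Z), ∃ g' : (L.obj X).obj ⟶ Z,
      g = (adj.unit.app X : X ⟶ (L.obj X).obj) ≫ g' := fun {Z} hZ g ↦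
    ⟨((adj.homEquiv X ⟨Z, hZ⟩).symm g).hom, by
      have := (adj.homEquiv X ⟨Z, hZ⟩).apply_symm_apply g
      rw [Adjunction.homEquiv_unit] at this
      exact this.symm⟩
  have hinj : ∀ {Z : C} (_ : P Z) (g : (L.obj X).obj ⟶ Z),
      (adj.unit.app X : X ⟶ (L.obj X).obj) ≫ g = 0 → g = 0 := fun {Z} hZ g hg ↦ by
    let Z' : P.FullSubcategory := ⟨Z, hZ⟩
    have : (P.homMk g : L.obj X ⟶ Z') = 0 := by
      apply (adj.homEquiv X Z').injective
      rw [Adjunction.homEquiv_unit, Adjunction.homEquiv_unit]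
      exact hg.trans comp_zero.symm
    exact congr_arg (fun f ↦ f.hom) this
  intro Z f hZ
  -- The unit followed by `w` is zero, and maps from the reflection into `P` are detected on the
  -- unit. So `f` extends along `u` to a map from `X`, which factors through the unit; but the unit
  -- kills `u`.
  have h₁ : w ≫ f⟦(1 : ℤ)⟧' = 0 := by
    apply hinj (P.le_shift (1 : ℤ) _ hZ)
    rw [← Category.assoc]
    have := comp_distTriang_mor_zero₂₃ _ hT
    exact (congr_arg (· ≫ f⟦(1 : ℤ)⟧') this).trans zero_comp
  obtain ⟨g, hg⟩ : ∃ g : X⟦(1 : ℤ)⟧ ⟶ Z⟦(1 : ℤ)⟧, f⟦(1 : ℤ)⟧' = (-u⟦(1 : ℤ)⟧') ≫ g := by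
    obtain ⟨g, hg⟩ := Triangle.yoneda_exact₃ _ (rot_of_distTriang _ hT) (f⟦(1 : ℤ)⟧') h₁
    exact ⟨g, hg⟩
  obtain ⟨g, rfl⟩ := (shiftFunctor C (1 : ℤ)).map_surjective g
  obtain ⟨g', rfl⟩ := hfac hZ g
  have h₂ : u ≫ (adj.unit.app X : X ⟶ (L.obj X).obj) = 0 := comp_distTriang_mor_zero₁₂ _ hT
  apply (shiftFunctor C (1 : ℤ)).map_injective
  rw [hg, Functor.map_zero, Preadditive.neg_comp, ← Functor.map_comp, reassoc_of% h₂,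
    zero_comp, Functor.map_zero, neg_zero]

/-- The cofibre of the counit `R X ⟶ X` of the coreflection onto a triangulated subcategory is
right orthogonal to this subcategory. -/
lemma rightOrthogonal_of_distTriang_counit {R : C ⥤ P.FullSubcategory} (adj : P.ι ⊣ R) {X W : C}
    {u : X ⟶ W} {w : W ⟶ (R.obj X).obj⟦(1 : ℤ)⟧}
    (hT : Triangle.mk (adj.counit.app X : (R.obj X).obj ⟶ X) u w ∈ distTriang C) :
    P.rightOrthogonal W := by
  have hfac : ∀ {Z : C} (_ : P Z) (g : Z ⟶ X), ∃ g' : Z ⟶ (R.obj X).obj,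
      g = g' ≫ (adj.counit.app X : (R.obj X).obj ⟶ X) := fun {Z} hZ g ↦
    ⟨((adj.homEquiv ⟨Z, hZ⟩ X) g).hom, by
      have := (adj.homEquiv ⟨Z, hZ⟩ X).symm_apply_apply g
      rw [Adjunction.homEquiv_counit] at this
      exact this.symm⟩
  have hinj : ∀ {Z : C} (_ : P Z) (g : Z ⟶ (R.obj X).obj),
      g ≫ (adj.counit.app X : (R.obj X).obj ⟶ X) = 0 → g = 0 := fun {Z} hZ g hg ↦ by
    let Z' : P.FullSubcategory := ⟨Z, hZ⟩
    have : (P.homMk g : Z' ⟶ R.obj X) = 0 := by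
      apply (adj.homEquiv Z' X).symm.injective
      rw [Adjunction.homEquiv_counit, Adjunction.homEquiv_counit]
      exact hg.trans zero_comp.symm
    exact congr_arg (fun f ↦ f.hom) this
  intro Z f hZ
  have hc : (adj.counit.app X : (R.obj X).obj ⟶ X) ≫ u = 0 := comp_distTriang_mor_zero₁₂ _ hT
  have h₀ : f ≫ w = 0 := by
    let ε : Z⟦(-1 : ℤ)⟧⟦(1 : ℤ)⟧ ≅ Z := (shiftEquiv C (1 : ℤ)).counitIso.app Z
    obtain ⟨g, hg⟩ : ∃ g : Z⟦(-1 : ℤ)⟧ ⟶ (R.obj X).obj, g⟦(1 : ℤ)⟧' = ε.hom ≫ f ≫ w :=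
      (shiftFunctor C (1 : ℤ)).map_surjective _
    have hg₀ : g = 0 := by
      apply hinj (P.le_shift (-1 : ℤ) _ hZ)
      apply (shiftFunctor C (1 : ℤ)).map_injective
      have : w ≫ (adj.counit.app X : (R.obj X).obj ⟶ X)⟦(1 : ℤ)⟧' = 0 :=
        comp_distTriang_mor_zero₃₁ _ hT
      rw [Functor.map_comp, hg, Functor.map_zero, Category.assoc, Category.assoc, this, comp_zero,
        comp_zero]
    rw [hg₀, Functor.map_zero] at hg
    exact (cancel_epi ε.hom).1 (hg.symm.trans comp_zero.symm)
  obtain ⟨g, rfl⟩ : ∃ g : Z ⟶ X, f = g ≫ u := Triangle.coyoneda_exact₃ _ hT f h₀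
  obtain ⟨g', rfl⟩ := hfac hZ g
  rw [Category.assoc, hc, comp_zero]

end

/-! ### Reflections, coreflections and strictness inside `C`. -/

namespace AdmissibleFiltration

section

variable {L : Type w} [Lattice L] [BoundedOrder L]
  {C : Type u} [Category.{v} C] [Preadditive C] [HasZeroObject C] [HasShift C ℤ]
  [∀ n : ℤ, (shiftFunctor C n).Additive] [Pretriangulated C]
  (F : AdmissibleFiltration L C)

/-- The left adjoint of the inclusion `C_I ⥤ C`. -/
noncomputable def lam (I : L) : C ⥤ (F.obj I).FullSubcategory :=
  have := F.leftAdmissible I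
  (F.obj I).ι.leftAdjoint

/-- The adjunction between `F.lam I` and the inclusion `C_I ⥤ C`. -/
noncomputable def lamAdj (I : L) : F.lam I ⊣ (F.obj I).ι :=
  have := F.leftAdmissible I
  Adjunction.ofIsRightAdjoint _

/-- The right adjoint of the inclusion `C_I ⥤ C`. -/
noncomputable def rho (I : L) : C ⥤ (F.obj I).FullSubcategory :=
  have := F.rightAdmissible I
  (F.obj I).ι.rightAdjoint

/-- The adjunction between the inclusion `C_I ⥤ C` and `F.rho I`. -/
noncomputable def rhoAdj (I : L) : (F.obj I).ι ⊣ F.rho I :=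
  have := F.rightAdmissible I
  Adjunction.ofIsLeftAdjoint _

noncomputable instance (I : L) : (F.lam I).CommShift ℤ := (F.lamAdj I).leftAdjointCommShift ℤ

noncomputable instance (I : L) : (F.rho I).CommShift ℤ := (F.rhoAdj I).rightAdjointCommShift ℤ

instance (I : L) : (F.lamAdj I).CommShift ℤ := (F.lamAdj I).commShift_of_rightAdjoint ℤ

instance (I : L) : (F.rhoAdj I).CommShift ℤ := (F.rhoAdj I).commShift_of_leftAdjoint ℤ

instance (I : L) : (F.lam I).IsTriangulated := (F.lamAdj I).isTriangulated_leftAdjoint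

instance (I : L) : (F.rho I).IsTriangulated := (F.rhoAdj I).isTriangulated_rightAdjoint

/-- The unit `X ⟶ lam I X`. -/
noncomputable abbrev toLam (I : L) (X : C) : X ⟶ ((F.lam I).obj X).obj := (F.lamAdj I).unit.app X

/-- The counit `rho I X ⟶ X`. -/
noncomputable abbrev fromRho (I : L) (X : C) : ((F.rho I).obj X).obj ⟶ X :=
  (F.rhoAdj I).counit.app X

lemma exists_distTriang_toLam (I : L) (X : C) :
    ∃ (W : C) (u : W ⟶ X) (w : ((F.lam I).obj X).obj ⟶ W⟦(1 : ℤ)⟧),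
      Triangle.mk u (F.toLam I X) w ∈ distTriang C ∧ (F.obj I).leftOrthogonal W := by
  obtain ⟨W, u, w, hT⟩ := distinguished_cocone_triangle₁ (F.toLam I X)
  exact ⟨W, u, w, hT, leftOrthogonal_of_distTriang_unit (F.obj I) (F.lamAdj I) hT⟩

lemma exists_distTriang_fromRho (I : L) (X : C) :
    ∃ (W : C) (u : X ⟶ W) (w : W ⟶ ((F.rho I).obj X).obj⟦(1 : ℤ)⟧),
      Triangle.mk (F.fromRho I X) u w ∈ distTriang C ∧ (F.obj I).rightOrthogonal W := by
  obtain ⟨W, u, w, hT⟩ := distinguished_cocone_triangle (F.fromRho I X)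
  exact ⟨W, u, w, hT, rightOrthogonal_of_distTriang_counit (F.obj I) (F.rhoAdj I) hT⟩

lemma isZero_lam_obj {I : L} {X : C} (hX : (F.obj I).leftOrthogonal X) :
    IsZero ((F.lam I).obj X) := by
  rw [IsZero.iff_id_eq_zero]
  apply ((F.lamAdj I).homEquiv _ _).injective
  rw [hX (((F.lamAdj I).homEquiv _ _) (𝟙 _)) ((F.lam I).obj X).property,
    hX (((F.lamAdj I).homEquiv _ _) 0) ((F.lam I).obj X).property]

lemma isZero_rho_obj {I : L} {X : C} (hX : (F.obj I).rightOrthogonal X) :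
    IsZero ((F.rho I).obj X) := by
  rw [IsZero.iff_id_eq_zero]
  apply ((F.rhoAdj I).homEquiv _ _).symm.injective
  rw [hX (((F.rhoAdj I).homEquiv _ _).symm (𝟙 _)) ((F.rho I).obj X).property,
    hX (((F.rhoAdj I).homEquiv _ _).symm 0) ((F.rho I).obj X).property]

lemma isIso_lam_map {I : L} {W X Y : C} {u : W ⟶ X} {f : X ⟶ Y} {w : Y ⟶ W⟦(1 : ℤ)⟧}
    (hT : Triangle.mk u f w ∈ distTriang C) (hW : (F.obj I).leftOrthogonal W) :
    IsIso ((F.lam I).map f) :=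
  (Triangle.isZero₁_iff_isIso₂ _ ((F.lam I).map_distinguished _ hT)).1 (F.isZero_lam_obj hW)

lemma isIso_rho_map {I : L} {X Y W : C} {f : X ⟶ Y} {u : Y ⟶ W} {w : W ⟶ X⟦(1 : ℤ)⟧}
    (hT : Triangle.mk f u w ∈ distTriang C) (hW : (F.obj I).rightOrthogonal W) :
    IsIso ((F.rho I).map f) :=
  (Triangle.isZero₃_iff_isIso₁ _ ((F.rho I).map_distinguished _ hT)).1 (F.isZero_rho_obj hW)

/-- Any object of `C_I` is isomorphic to its reflection. -/
noncomputable def lamObjIso {I : L} {X : C} (hX : F.obj I X) : (F.lam I).obj X ≅ ⟨X, hX⟩ :=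
  asIso ((F.lamAdj I).counit.app ⟨X, hX⟩)

/-- Any object of `C_I` is isomorphic to its coreflection. -/
noncomputable def rhoObjIso {I : L} {X : C} (hX : F.obj I X) : ⟨X, hX⟩ ≅ (F.rho I).obj X :=
  asIso ((F.rhoAdj I).unit.app ⟨X, hX⟩)

lemma leftOrthogonal_antitone {I J : L} (h : I ≤ J) :
    (F.obj J).leftOrthogonal ≤ (F.obj I).leftOrthogonal :=
  fun _ hX _ f hY ↦ hX f (F.monotone h _ hY)

lemma rightOrthogonal_antitone {I J : L} (h : I ≤ J) :
    (F.obj J).rightOrthogonal ≤ (F.obj I).rightOrthogonal :=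
  fun _ hX _ f hY ↦ hX f (F.monotone h _ hY)

lemma isIso_lam_map_toLam {I J : L} (h : I ≤ J) (X : C) :
    IsIso ((F.lam I).map (F.toLam J X)) := by
  obtain ⟨W, u, w, hT, hW⟩ := F.exists_distTriang_toLam J X
  exact F.isIso_lam_map hT (F.leftOrthogonal_antitone h _ hW)

lemma isIso_rho_map_fromRho {I J : L} (h : I ≤ J) (X : C) :
    IsIso ((F.rho I).map (F.fromRho J X)) := by
  obtain ⟨W, u, w, hT, hW⟩ := F.exists_distTriang_fromRho J X
  exact F.isIso_rho_map hT (F.rightOrthogonal_antitone h _ hW)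

variable [IsTriangulated C]

variable {F} in
-- Strictness kills the image of `f` in the quotient by `C_{I ⊓ J}`, and passing to this quotient
-- does not change morphisms out of an object left orthogonal to `C_{I ⊓ J}`.
lemma IsStrict.hom_eq_zero_of_leftOrthogonal (hF : F.IsStrict) {I J : L} {X Y : C}
    (hX : F.obj I X) (hX' : (F.obj (I ⊓ J)).leftOrthogonal X) (hY : F.obj J Y) (f : X ⟶ Y) :
    f = 0 := by
  let X' : (F.obj (I ⊔ J)).FullSubcategory := ⟨X, F.monotone le_sup_left _ hX⟩
  let Y' : (F.obj (I ⊔ J)).FullSubcategory := ⟨Y, F.monotone le_sup_right _ hY⟩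
  have h : (F.sub (I ⊓ J) (I ⊔ J)).leftOrthogonal X' := fun Z g hZ ↦ by
    ext
    exact hX' g.hom hZ
  have := (h.map_bijective_of_isTriangulated (F.quotientFunctor (I ⊓ J) (I ⊔ J)) Y').1
    (a₁ := ObjectProperty.homMk f) (a₂ := 0)
    ((hF I J X' Y' hX hY _).trans (Functor.map_zero _ _ _).symm)
  exact congr_arg (fun f ↦ f.hom) this

variable {F} in
lemma IsStrict.hom_eq_zero_of_rightOrthogonal (hF : F.IsStrict) {I J : L} {X Y : C}
    (hX : F.obj I X) (hY : F.obj J Y) (hY' : (F.obj (I ⊓ J)).rightOrthogonal Y) (f : X ⟶ Y) :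
    f = 0 := by
  let X' : (F.obj (I ⊔ J)).FullSubcategory := ⟨X, F.monotone le_sup_left _ hX⟩
  let Y' : (F.obj (I ⊔ J)).FullSubcategory := ⟨Y, F.monotone le_sup_right _ hY⟩
  have h : (F.sub (I ⊓ J) (I ⊔ J)).rightOrthogonal Y' := fun Z g hZ ↦ by
    ext
    exact hY' g.hom hZ
  have := (h.map_bijective_of_isTriangulated (F.quotientFunctor (I ⊓ J) (I ⊔ J)) X').1
    (a₁ := ObjectProperty.homMk f) (a₂ := 0)
    ((hF I J X' Y' hX hY _).trans (Functor.map_zero _ _ _).symm)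
  exact congr_arg (fun f ↦ f.hom) this

variable {F} in
-- The fibre of `Y ⟶ lam (I ⊓ J) Y` lies in `C_J` and is left orthogonal to `C_{I ⊓ J}`, hence by
-- strictness to all of `C_I`. Therefore `lam I Y ≅ lam (I ⊓ J) Y`.
lemma IsStrict.lam_mem (hF : F.IsStrict) {I J : L} {Y : C} (hY : F.obj J Y) :
    F.obj (I ⊓ J) ((F.lam I).obj Y).obj := by
  obtain ⟨W, u, w, hT, hW⟩ := F.exists_distTriang_toLam (I ⊓ J) Y
  let Z := ((F.lam (I ⊓ J)).obj Y).obj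
  have hZ : F.obj (I ⊓ J) Z := ((F.lam (I ⊓ J)).obj Y).property
  have hWJ : F.obj J W := (F.obj J).ext_of_isTriangulatedClosed₁ _ hT hY
    (F.monotone inf_le_right _ hZ)
  rw [inf_comm] at hW
  have := F.isIso_lam_map hT (I := I) (fun X f hX ↦
    hF.hom_eq_zero_of_leftOrthogonal hWJ hW hX f)
  exact (F.obj (I ⊓ J)).prop_of_iso ((F.obj I).ι.mapIso
    (asIso ((F.lam I).map (F.toLam (I ⊓ J) Y)) ≪≫
    F.lamObjIso (F.monotone inf_le_left _ hZ))).symm hZ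

variable {F} in
lemma IsStrict.rho_mem (hF : F.IsStrict) {I J : L} {Y : C} (hY : F.obj J Y) :
    F.obj (I ⊓ J) ((F.rho I).obj Y).obj := by
  obtain ⟨W, u, w, hT, hW⟩ := F.exists_distTriang_fromRho (I ⊓ J) Y
  let Z := ((F.rho (I ⊓ J)).obj Y).obj
  have hZ : F.obj (I ⊓ J) Z := ((F.rho (I ⊓ J)).obj Y).property
  have hWJ : F.obj J W := (F.obj J).ext_of_isTriangulatedClosed₃ _ hT
    (F.monotone inf_le_right _ hZ) hY
  have := F.isIso_rho_map hT (I := I) (fun X f hX ↦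
    hF.hom_eq_zero_of_rightOrthogonal hX hWJ hW f)
  exact (F.obj (I ⊓ J)).prop_of_iso ((F.obj I).ι.mapIso
    (F.rhoObjIso (F.monotone inf_le_left _ hZ) ≪≫
    asIso ((F.rho I).map (F.fromRho (I ⊓ J) Y)))) hZ

variable {F} in
-- The fibre `V` of `W ⟶ lam J W` is left orthogonal to `C_J`, and also to `C_I` once `lam J W` is.
-- By the axiom on joins `V` is then left orthogonal to `C_{I ⊔ J}`, which contains it, so `V = 0`.
lemma IsStrict.mem_of_leftOrthogonal (hF : F.IsStrict) {I J : L} {W : C} (hW : F.obj (I ⊔ J) W)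
    (hW' : (F.obj I).leftOrthogonal W) : F.obj J W := by
  obtain ⟨V, u, w, hT, hV⟩ := F.exists_distTriang_toLam J W
  have hY := ((F.lam J).obj W).property
  -- By strictness a map from `lam J W` to `X` in `C_I` factors through `rho (I ⊓ J) X`. That object
  -- lies in `C_J`, so the factor is determined by its restriction to `W`, which is zero since the
  -- object also lies in `C_I`.
  have hYI : (F.obj I).leftOrthogonal ((F.lam J).obj W).obj := fun X f hX ↦ by
    obtain ⟨X', a, b, hT', hX'⟩ := F.exists_distTriang_fromRho (I ⊓ J) X
    have hρ := ((F.rho (I ⊓ J)).obj X).property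
    have hX'' : F.obj I X' := (F.obj I).ext_of_isTriangulatedClosed₃ _ hT'
      (F.monotone inf_le_left _ hρ) hX
    rw [inf_comm] at hX'
    obtain ⟨g, rfl⟩ : ∃ g : ((F.lam J).obj W).obj ⟶ ((F.rho (I ⊓ J)).obj X).obj,
        f = g ≫ F.fromRho (I ⊓ J) X :=
      Triangle.coyoneda_exact₂ _ hT' f (hF.hom_eq_zero_of_rightOrthogonal hY hX'' hX' _)
    have hg : F.toLam J W ≫ g = 0 := hW' _ (F.monotone inf_le_left _ hρ)
    let Z : (F.obj J).FullSubcategory := ⟨_, F.monotone inf_le_right _ hρ⟩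
    have : ((F.obj J).homMk g : (F.lam J).obj W ⟶ Z) = 0 := by
      apply ((F.lamAdj J).homEquiv W Z).injective
      rw [Adjunction.homEquiv_unit, Adjunction.homEquiv_unit]
      exact hg.trans comp_zero.symm
    rw [show g = 0 from congr_arg (fun f ↦ f.hom) this, zero_comp]
  have hVI : (F.obj I).leftOrthogonal V :=
    (F.obj I).leftOrthogonal.ext_of_isTriangulatedClosed₁ _ hT hW' hYI
  have hVM : F.obj (I ⊔ J) V := (F.obj (I ⊔ J)).ext_of_isTriangulatedClosed₁ _ hT hW
    (F.monotone le_sup_right _ hY)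
  have hV₀ : (F.obj (I ⊔ J)).leftOrthogonal V := by
    rw [F.leftOrthogonal_sup]
    exact ⟨hVI, hV⟩
  have hVz : IsZero V := by
    rw [IsZero.iff_id_eq_zero]
    exact hV₀ _ hVM
  have : IsIso (F.toLam J W) := (Triangle.isZero₁_iff_isIso₂ _ hT).1 hVz
  exact (F.obj J).prop_of_iso (asIso (F.toLam J W)).symm hY

end

end AdmissibleFiltration

/-! ### Adjoints of a localization functor and kernels of Verdier quotients. -/

section

variable {C : Type u} [Category.{v} C] {D : Type u₁} [Category.{v₁} D] {j : C ⥤ D}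

/-- If any object `Z` lifts to an object `W` such that `j` induces bijections on morphisms from `W`,
then `j` has a fully faithful left adjoint. -/
lemma exists_fullyFaithful_leftAdjoint
    (h : ∀ Z : D, ∃ W : C, Nonempty (j.obj W ≅ Z) ∧
      ∀ Y : C, Function.Bijective (j.map : (W ⟶ Y) → (j.obj W ⟶ j.obj Y))) :
    ∃ jL : D ⥤ C, Nonempty (jL ⊣ j) ∧ jL.Full ∧ jL.Faithful := by
  choose W e hW using h
  let adj := Adjunction.adjunctionOfEquivLeft (G := j) (F_obj := W)
    (fun Z Y ↦ (Equiv.ofBijective _ (hW Z Y)).trans ((e Z).some.homCongr (Iso.refl _)))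
    (fun Z Y Y' g f ↦ by simp)
  have (Z : D) : IsIso (adj.unit.app Z) := by
    have : adj.unit.app Z = (e Z).some.inv := by
      simp [adj, Adjunction.adjunctionOfEquivLeft]
    rw [this]
    infer_instance
  have : IsIso adj.unit := NatIso.isIso_of_isIso_app _
  exact ⟨_, ⟨adj⟩, adj.fullyFaithfulLOfIsIsoUnit.full, adj.fullyFaithfulLOfIsIsoUnit.faithful⟩

/-- If any object `Z` lifts to an object `W` such that `j` induces bijections on morphisms to `W`,
then `j` has a fully faithful right adjoint. -/
lemma exists_fullyFaithful_rightAdjoint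
    (h : ∀ Z : D, ∃ W : C, Nonempty (j.obj W ≅ Z) ∧
      ∀ Y : C, Function.Bijective (j.map : (Y ⟶ W) → (j.obj Y ⟶ j.obj W))) :
    ∃ jR : D ⥤ C, Nonempty (j ⊣ jR) ∧ jR.Full ∧ jR.Faithful := by
  choose W e hW using h
  let adj := Adjunction.adjunctionOfEquivRight (F := j) (G_obj := W)
    (fun Y Z ↦ (((Equiv.ofBijective _ (hW Z Y)).trans
      ((Iso.refl _).homCongr (e Z).some))).symm)
    (fun Y Y' Z f g ↦ by
      apply (Equiv.ofBijective _ (hW Z Y)).injective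
      simp [Equiv.ofBijective_apply_symm_apply])
  have (Z : D) : IsIso (adj.counit.app Z) := by
    have : adj.counit.app Z = (e Z).some.hom := by
      simp [adj, Adjunction.adjunctionOfEquivRight]
    rw [this]
    infer_instance
  have : IsIso adj.counit := NatIso.isIso_of_isIso_app _
  exact ⟨_, ⟨adj⟩, adj.fullyFaithfulROfIsIsoCounit.full, adj.fullyFaithfulROfIsIsoCounit.faithful⟩

lemma bijective_map_of_iso {G G' : C ⥤ D} (e : G ≅ G') {X Y : C}
    (h : Function.Bijective (G.map : (X ⟶ Y) → _)) :
    Function.Bijective (G'.map : (X ⟶ Y) → _) := by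
  have : (G'.map : (X ⟶ Y) → _) = (e.app X).homCongr (e.app Y) ∘ G.map := by
    ext f
    simp
  rw [this]
  exact (Equiv.bijective _).comp h

end

section

variable {C : Type u} [Category.{v} C] [Preadditive C] [HasZeroObject C] [HasShift C ℤ]
  [∀ n : ℤ, (shiftFunctor C n).Additive] [Pretriangulated C] [IsTriangulated C]
  (P : ObjectProperty C) [P.IsTriangulated]

open scoped ZeroObject in
lemma isZero_trW_Q_obj {X : C} (hX : P X) : IsZero (P.trW.Q.obj X) := by
  have h : P.trW (0 : 0 ⟶ X) := ObjectProperty.trW.mk P (contractible_distinguished₁ X) hX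
  have := Localization.inverts P.trW.Q P.trW _ h
  exact (P.trW.Q.map_isZero (isZero_zero C)).of_iso (asIso (P.trW.Q.map (0 : 0 ⟶ X))).symm

lemma isZero_of_isZero_trW_Q_obj {W : C} (hW : P.leftOrthogonal W)
    (h : IsZero (P.trW.Q.obj W)) : IsZero W := by
  rw [IsZero.iff_id_eq_zero]
  exact (hW.map_bijective_of_isTriangulated P.trW.Q W).1 (h.eq_of_src _ _)

end

lemma CategoryTheory.MorphismProperty.Q_obj_surjective {C : Type u} [Category.{v} C]
    (W : MorphismProperty C) : Function.Surjective W.Q.obj :=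
  (Localization.Construction.objEquiv W).surjective

/-! ### Adjoint functors between subquotients. -/

namespace AdmissibleFiltration

variable {L : Type w} [Lattice L] [BoundedOrder L]
  {C : Type u} [Category.{v} C] [Preadditive C] [HasZeroObject C] [HasShift C ℤ]
  [∀ n : ℤ, (shiftFunctor C n).Additive] [Pretriangulated C]
  (F : AdmissibleFiltration L C)

/-- The left adjoint `C_M ⥤ C_A` of the inclusion of `C_A`. -/
noncomputable abbrev lamOn (A M : L) : (F.obj M).FullSubcategory ⥤ (F.obj A).FullSubcategory :=
  (F.obj M).ι ⋙ F.lam A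

/-- The right adjoint `C_M ⥤ C_A` of the inclusion of `C_A`. -/
noncomputable abbrev rhoOn (A M : L) : (F.obj M).FullSubcategory ⥤ (F.obj A).FullSubcategory :=
  (F.obj M).ι ⋙ F.rho A

/-- The adjunction between `F.lamOn A M` and the inclusion `C_A ⥤ C_M`. -/
noncomputable def lamOnAdj {A M : L} (h : A ≤ M) : F.lamOn A M ⊣ F.inclusion h :=
  (F.lamAdj A).restrictFullyFaithful (F.obj M).fullyFaithfulι (Functor.FullyFaithful.id _)
    (Iso.refl _) (Iso.refl _)

/-- The adjunction between the inclusion `C_A ⥤ C_M` and `F.rhoOn A M`. -/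
noncomputable def rhoOnAdj {A M : L} (h : A ≤ M) : F.inclusion h ⊣ F.rhoOn A M :=
  (F.rhoAdj A).restrictFullyFaithful (Functor.FullyFaithful.id _) (F.obj M).fullyFaithfulι
    (Iso.refl _) (Iso.refl _)

instance {A M : L} (h : A ≤ M) : (F.inclusion h).Full :=
  inferInstanceAs ((F.obj M).lift (F.obj A).ι _).Full

instance {A M : L} (h : A ≤ M) : (F.inclusion h).Faithful :=
  inferInstanceAs ((F.obj M).lift (F.obj A).ι _).Faithful

variable [IsTriangulated C]

variable {F} in
/-- `lamOn A M` sends morphisms with cone in `C_J` to morphisms with cone in `C_{A ⊓ J}`. -/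
noncomputable def IsStrict.lamLocalizerMorphism (hF : F.IsStrict) {A I J M : L} (hI : A ⊓ J = I) :
    LocalizerMorphism (F.sub J M).trW (F.sub I A).trW where
  functor := F.lamOn A M
  map X Y f hf := by
    obtain ⟨Z, g, h, hT, hZ⟩ := hf
    have hZ' : F.obj I ((F.lamOn A M).obj Z).obj := hI ▸ hF.lam_mem hZ
    exact ⟨_, _, _, (F.lamOn A M).map_distinguished _ hT, hZ'⟩

variable {F} in
/-- `rhoOn A M` sends morphisms with cone in `C_J` to morphisms with cone in `C_{A ⊓ J}`. -/
noncomputable def IsStrict.rhoLocalizerMorphism (hF : F.IsStrict) {A I J M : L} (hI : A ⊓ J = I) :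
    LocalizerMorphism (F.sub J M).trW (F.sub I A).trW where
  functor := F.rhoOn A M
  map X Y f hf := by
    obtain ⟨Z, g, h, hT, hZ⟩ := hf
    have hZ' : F.obj I ((F.rhoOn A M).obj Z).obj := hI ▸ hF.rho_mem hZ
    exact ⟨_, _, _, (F.rhoOn A M).map_distinguished _ hT, hZ'⟩

variable {F} in
/-- The functor `C_M / C_J ⥤ C_A / C_I` induced by `lamOn A M`. -/
noncomputable abbrev IsStrict.lamMap (hF : F.IsStrict) {A I J M : L} (hI : A ⊓ J = I) :
    F.Subquotient J M ⥤ F.Subquotient I A :=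
  (hF.lamLocalizerMorphism hI).localizedFunctor (F.quotientFunctor J M) (F.quotientFunctor I A)

variable {F} in
/-- The functor `C_M / C_J ⥤ C_A / C_I` induced by `rhoOn A M`. -/
noncomputable abbrev IsStrict.rhoMap (hF : F.IsStrict) {A I J M : L} (hI : A ⊓ J = I) :
    F.Subquotient J M ⥤ F.Subquotient I A :=
  (hF.rhoLocalizerMorphism hI).localizedFunctor (F.quotientFunctor J M) (F.quotientFunctor I A)

/-- The compatibility of `F.map` with the quotient functors. -/
noncomputable def mapObjIso {I J I' J' : L} (hI : I ≤ I') (hJ : J ≤ J')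
    (X : (F.obj J).FullSubcategory) :
    (F.map hI hJ).obj ((F.quotientFunctor I J).obj X) ≅
      (F.quotientFunctor I' J').obj ((F.inclusion hJ).obj X) :=
  ((CatCommSq.iso (F.localizerMorphism hI hJ).functor (F.quotientFunctor I J)
    (F.quotientFunctor I' J') (F.map hI hJ)).app X).symm

variable {F} in
/-- The compatibility of `lamMap` with the quotient functors. -/
noncomputable def IsStrict.lamMapObjIso (hF : F.IsStrict) {A I J M : L} (hI : A ⊓ J = I)
    (X : (F.obj M).FullSubcategory) :
    (hF.lamMap (M := M) hI).obj ((F.quotientFunctor J M).obj X) ≅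
      (F.quotientFunctor I A).obj ((F.lam A).obj X.obj) :=
  ((CatCommSq.iso (hF.lamLocalizerMorphism (M := M) hI).functor (F.quotientFunctor J M)
    (F.quotientFunctor I A) (hF.lamMap hI)).app X).symm

variable {F} in
/-- The compatibility of `rhoMap` with the quotient functors. -/
noncomputable def IsStrict.rhoMapObjIso (hF : F.IsStrict) {A I J M : L} (hI : A ⊓ J = I)
    (X : (F.obj M).FullSubcategory) :
    (hF.rhoMap (M := M) hI).obj ((F.quotientFunctor J M).obj X) ≅
      (F.quotientFunctor I A).obj ((F.rho A).obj X.obj) :=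
  ((CatCommSq.iso (hF.rhoLocalizerMorphism (M := M) hI).functor (F.quotientFunctor J M)
    (F.quotientFunctor I A) (hF.rhoMap hI)).app X).symm

variable {F} in
/-- The adjunction between `lamMap` and the inclusion `C_A / C_I ⥤ C_M / C_J`. -/
noncomputable def IsStrict.lamMapAdj (hF : F.IsStrict) {A I J M : L} (hI : A ⊓ J = I)
    (hIJ : I ≤ J) (hA : A ≤ M) : hF.lamMap hI ⊣ F.map hIJ hA :=
  Adjunction.localization (G := (hF.lamLocalizerMorphism hI).functor)
    (F := (F.localizerMorphism hIJ hA).functor) (F.lamOnAdj hA)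
    (F.quotientFunctor J M) (F.sub J M).trW (F.quotientFunctor I A) (F.sub I A).trW
    (hF.lamMap hI) (F.map hIJ hA)

variable {F} in
/-- The adjunction between the inclusion `C_A / C_I ⥤ C_M / C_J` and `rhoMap`. -/
noncomputable def IsStrict.rhoMapAdj (hF : F.IsStrict) {A I J M : L} (hI : A ⊓ J = I)
    (hIJ : I ≤ J) (hA : A ≤ M) : F.map hIJ hA ⊣ hF.rhoMap hI :=
  Adjunction.localization (G := (F.localizerMorphism hIJ hA).functor)
    (F := (hF.rhoLocalizerMorphism hI).functor) (F.rhoOnAdj hA)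
    (F.quotientFunctor I A) (F.sub I A).trW (F.quotientFunctor J M) (F.sub J M).trW
    (F.map hIJ hA) (hF.rhoMap hI)

variable {F} in
/-- The inclusion `C_A / C_{A ⊓ J} ⥤ C_M / C_J` is fully faithful. -/
noncomputable def IsStrict.fullyFaithfulMap (hF : F.IsStrict) {A I J M : L} (hI : A ⊓ J = I)
    (hIJ : I ≤ J) (hA : A ≤ M) : (F.map hIJ hA).FullyFaithful :=
  have (X : F.Subquotient I A) : IsIso ((hF.lamMapAdj hI hIJ hA).counit.app X) := by
    obtain ⟨X, rfl⟩ := (F.sub I A).trW.Q_obj_surjective X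
    have h : IsIso ((F.quotientFunctor I A).map ((F.lamOnAdj hA).counit.app X)) := inferInstance
    have := Adjunction.localization_counit_app (G := (hF.lamLocalizerMorphism hI).functor)
      (F := (F.localizerMorphism hIJ hA).functor) (F.lamOnAdj hA)
      (F.quotientFunctor J M) (F.sub J M).trW (F.quotientFunctor I A) (F.sub I A).trW
      (hF.lamMap hI) (F.map hIJ hA) X
    dsimp only [lamMapAdj]
    rw [this]
    exact @IsIso.comp_isIso _ _ _ _ _ _ _ inferInstance
      (@IsIso.comp_isIso _ _ _ _ _ _ _ inferInstance h)
  have : IsIso (hF.lamMapAdj hI hIJ hA).counit := NatIso.isIso_of_isIso_app _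
  (hF.lamMapAdj hI hIJ hA).fullyFaithfulROfIsIsoCounit

/-- Exactness can be tested after precomposition with the quotient functor, since every arrow of the
quotient lifts up to isomorphism. -/
instance isTriangulated_map {I J I' J' : L} (hI : I ≤ I') (hJ : J ≤ J') :
    (F.map hI hJ).IsTriangulated := by
  have := Localization.essSurj_mapArrow (F.quotientFunctor I J) (F.sub I J).trW
  have : (F.localizerMorphism hI hJ).functor.IsTriangulated :=
    inferInstanceAs (F.inclusion hJ).IsTriangulated
  let e := CatCommSq.iso (F.localizerMorphism hI hJ).functor (F.quotientFunctor I J)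
    (F.quotientFunctor I' J') (F.map hI hJ)
  have : NatTrans.CommShift e.symm.hom ℤ := inferInstanceAs (NatTrans.CommShift e.inv ℤ)
  exact Functor.isTriangulated_of_precomp_iso e.symm

end AdmissibleFiltration

/-! ### Recollements of subquotients. -/

namespace AdmissibleFiltration

variable {L : Type w} [Lattice L] [BoundedOrder L]
  {C : Type u} [Category.{v} C] [Preadditive C] [HasZeroObject C] [HasShift C ℤ]
  [∀ n : ℤ, (shiftFunctor C n).Additive] [Pretriangulated C]
  (F : AdmissibleFiltration L C)

/-- The triangle of the reflection onto `C_A`, in `C_M`. -/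
lemma exists_distTriang_lamOn {A M : L} (h : A ≤ M) (X : (F.obj M).FullSubcategory) :
    ∃ (W : (F.obj M).FullSubcategory) (u : W ⟶ X)
      (v : X ⟶ (F.inclusion h).obj ((F.lam A).obj X.obj))
      (w : (F.inclusion h).obj ((F.lam A).obj X.obj) ⟶ W⟦(1 : ℤ)⟧),
      Triangle.mk u v w ∈ distTriang _ ∧ (F.obj A).leftOrthogonal W.obj := by
  let v : X ⟶ (F.inclusion h).obj ((F.lam A).obj X.obj) :=
    ObjectProperty.homMk (F.toLam A X.obj)
  obtain ⟨W, u, w, hT⟩ := distinguished_cocone_triangle₁ v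
  exact ⟨W, u, v, w, hT, leftOrthogonal_of_distTriang_unit (F.obj A) (F.lamAdj A)
    ((F.obj M).ι.map_distinguished _ hT)⟩

/-- The triangle of the coreflection onto `C_A`, in `C_M`. -/
lemma exists_distTriang_rhoOn {A M : L} (h : A ≤ M) (X : (F.obj M).FullSubcategory) :
    ∃ (W : (F.obj M).FullSubcategory) (u : (F.inclusion h).obj ((F.rho A).obj X.obj) ⟶ X)
      (v : X ⟶ W) (w : W ⟶ ((F.inclusion h).obj ((F.rho A).obj X.obj))⟦(1 : ℤ)⟧),
      Triangle.mk u v w ∈ distTriang _ ∧ (F.obj A).rightOrthogonal W.obj := by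
  let u : (F.inclusion h).obj ((F.rho A).obj X.obj) ⟶ X :=
    ObjectProperty.homMk (F.fromRho A X.obj)
  obtain ⟨W, v, w, hT⟩ := distinguished_cocone_triangle u
  exact ⟨W, u, v, w, hT, rightOrthogonal_of_distTriang_counit (F.obj A) (F.rhoAdj A)
    ((F.obj M).ι.map_distinguished _ hT)⟩

variable [IsTriangulated C]

/-- If `X` dies in the quotient, so does the fibre of `X ⟶ lam I X`. This fibre is left orthogonal
to `C_I`, so it is already zero, and `X` is isomorphic to its reflection. -/
lemma isZero_quotientFunctor_obj_iff {I J : L} (h : I ≤ J) (X : (F.obj J).FullSubcategory) :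
    IsZero ((F.quotientFunctor I J).obj X) ↔ F.obj I X.obj := by
  refine ⟨fun hX ↦ ?_, fun hX ↦ isZero_trW_Q_obj (F.sub I J) hX⟩
  obtain ⟨W, u, v, w, hT, hW⟩ := F.exists_distTriang_lamOn h X
  have hZ : F.obj I ((F.lam I).obj X.obj).obj := ((F.lam I).obj X.obj).property
  have hWQ : IsZero ((F.quotientFunctor I J).obj W) :=
    Triangle.isZero₁_of_isZero₂₃ _ ((F.quotientFunctor I J).map_distinguished _ hT) hX
      (isZero_trW_Q_obj (F.sub I J) hZ)
  have hW₀ : IsZero W := isZero_of_isZero_trW_Q_obj (F.sub I J) (fun Z f hZ ↦ by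
    ext
    exact hW f.hom hZ) hWQ
  have : IsIso v := (Triangle.isZero₁_iff_isIso₂ _ hT).1 hW₀
  exact (F.obj I).prop_of_iso ((F.obj J).ι.mapIso (asIso v)).symm hZ

/-- The composition `C_M ⥤ C_M / C_J ⥤ C_M / C_K` is the quotient functor. -/
noncomputable def quotientFunctorCompMapIso {J K M : L} (hJK : J ≤ K) :
    F.quotientFunctor J M ⋙ F.map hJK (le_refl M) ≅ F.quotientFunctor K M :=
  (CatCommSq.iso (F.localizerMorphism hJK (le_refl M)).functor (F.quotientFunctor J M)
    (F.quotientFunctor K M) (F.map hJK (le_refl M))).symm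

/-- Morphisms out of `W` agree in `C_M`, `C_M / C_J` and `C_M / C_K`, because `W` is left orthogonal
to both `C_J` and `C_K`. -/
lemma bijective_quotientMap_of_leftOrthogonal {J K M : L} (hJK : J ≤ K)
    {W : (F.obj M).FullSubcategory} (hW : (F.obj K).leftOrthogonal W.obj)
    (Y : F.Subquotient J M) :
    Function.Bijective ((F.map hJK (le_refl M)).map :
      ((F.quotientFunctor J M).obj W ⟶ Y) → _) := by
  obtain ⟨Y, rfl⟩ := (F.sub J M).trW.Q_obj_surjective Y
  have hWJ : (F.sub J M).leftOrthogonal W := fun Z f hZ ↦ by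
    ext
    exact hW f.hom (F.monotone hJK _ hZ)
  have hWK : (F.sub K M).leftOrthogonal W := fun Z f hZ ↦ by
    ext
    exact hW f.hom hZ
  have h₁ := hWJ.map_bijective_of_isTriangulated (F.quotientFunctor J M) Y
  have h₂ := bijective_map_of_iso (F.quotientFunctorCompMapIso (M := M) hJK).symm
    (hWK.map_bijective_of_isTriangulated (F.quotientFunctor K M) Y)
  exact (Function.Bijective.of_comp_iff _ h₁).1 h₂

lemma bijective_quotientMap_of_rightOrthogonal {J K M : L} (hJK : J ≤ K)
    {W : (F.obj M).FullSubcategory} (hW : (F.obj K).rightOrthogonal W.obj)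
    (Y : F.Subquotient J M) :
    Function.Bijective ((F.map hJK (le_refl M)).map :
      (Y ⟶ (F.quotientFunctor J M).obj W) → _) := by
  obtain ⟨Y, rfl⟩ := (F.sub J M).trW.Q_obj_surjective Y
  have hWJ : (F.sub J M).rightOrthogonal W := fun Z f hZ ↦ by
    ext
    exact hW f.hom (F.monotone hJK _ hZ)
  have hWK : (F.sub K M).rightOrthogonal W := fun Z f hZ ↦ by
    ext
    exact hW f.hom hZ
  have h₁ := hWJ.map_bijective_of_isTriangulated (F.quotientFunctor J M) Y
  have h₂ := bijective_map_of_iso (F.quotientFunctorCompMapIso (M := M) hJK).symm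
    (hWK.map_bijective_of_isTriangulated (F.quotientFunctor K M) Y)
  exact (Function.Bijective.of_comp_iff _ h₁).1 h₂

lemma isIso_quotientFunctor_map_of_distTriang₁ {K M : L} {W X Z : (F.obj M).FullSubcategory}
    {u : W ⟶ X} {v : X ⟶ Z} {w : Z ⟶ W⟦(1 : ℤ)⟧} (hT : Triangle.mk u v w ∈ distTriang _)
    (hZ : F.obj K Z.obj) : IsIso ((F.quotientFunctor K M).map u) :=
  (Triangle.isZero₃_iff_isIso₁ _ ((F.quotientFunctor K M).map_distinguished _ hT)).1
    (isZero_trW_Q_obj (F.sub K M) hZ)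

lemma isIso_quotientFunctor_map_of_distTriang₂ {K M : L} {W X Z : (F.obj M).FullSubcategory}
    {u : W ⟶ X} {v : X ⟶ Z} {w : Z ⟶ W⟦(1 : ℤ)⟧} (hT : Triangle.mk u v w ∈ distTriang _)
    (hW : F.obj K W.obj) : IsIso ((F.quotientFunctor K M).map v) :=
  (Triangle.isZero₁_iff_isIso₂ _ ((F.quotientFunctor K M).map_distinguished _ hT)).1
    (isZero_trW_Q_obj (F.sub K M) hW)

variable {F} in
/-- For `A, J ≤ M`, the inclusion `C_A / C_{A ⊓ J} ⥤ C_M / C_J` and the quotient functor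
`C_M / C_J ⥤ C_M / C_{A ⊔ J}` form a recollement. -/
theorem IsStrict.isRecollement (hF : F.IsStrict) {A I J K M : L} (hI : A ⊓ J = I) (hK : A ⊔ J = K)
    (hIJ : I ≤ J) (hJK : J ≤ K) (hAM : A ≤ M) (hKM : K ≤ M) :
    IsRecollement (F.map hIJ hAM) (F.map hJK (le_refl M)) where
  isTriangulated_i := inferInstance
  isTriangulated_j := inferInstance
  full_i := (hF.fullyFaithfulMap hI hIJ hAM).full
  faithful_i := (hF.fullyFaithfulMap hI hIJ hAM).faithful
  exists_leftAdjoint_i := ⟨_, ⟨hF.lamMapAdj hI hIJ hAM⟩⟩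
  exists_rightAdjoint_i := ⟨_, ⟨hF.rhoMapAdj hI hIJ hAM⟩⟩
  -- `j_!` sends the class of `X` to the fibre of `X ⟶ lam K X`; dually `j_*` takes the cofibre of
  -- `rho K X ⟶ X`.
  exists_leftAdjoint_j := exists_fullyFaithful_leftAdjoint (fun Z ↦ by
    obtain ⟨X, rfl⟩ := (F.sub K M).trW.Q_obj_surjective Z
    obtain ⟨W, u, v, w, hT, hW⟩ := F.exists_distTriang_lamOn hKM X
    have := F.isIso_quotientFunctor_map_of_distTriang₁ hT ((F.lam K).obj X.obj).property
    exact ⟨_, ⟨F.mapObjIso hJK (le_refl M) W ≪≫ asIso ((F.quotientFunctor K M).map u)⟩,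
      F.bijective_quotientMap_of_leftOrthogonal hJK hW⟩)
  exists_rightAdjoint_j := exists_fullyFaithful_rightAdjoint (fun Z ↦ by
    obtain ⟨X, rfl⟩ := (F.sub K M).trW.Q_obj_surjective Z
    obtain ⟨W, u, v, w, hT, hW⟩ := F.exists_distTriang_rhoOn hKM X
    have := F.isIso_quotientFunctor_map_of_distTriang₂ hT ((F.rho K).obj X.obj).property
    exact ⟨_, ⟨F.mapObjIso hJK (le_refl M) W ≪≫ (asIso ((F.quotientFunctor K M).map v)).symm⟩,
      F.bijective_quotientMap_of_rightOrthogonal hJK hW⟩)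
  isZero_obj_iff X := by
    obtain ⟨X, rfl⟩ := (F.sub J M).trW.Q_obj_surjective X
    have h := (F.mapObjIso hJK (le_refl M) X).isZero_iff
    refine h.trans ((F.isZero_quotientFunctor_obj_iff hKM _).trans ⟨fun hX ↦ ?_, ?_⟩)
    -- The fibre of `X ⟶ lam A X` lies in `C_{A ⊔ J}` and is left orthogonal to `C_A`, hence lies in
    -- `C_J`: modulo `C_J`, `X` is its reflection in `C_A`.
    · obtain ⟨W, u, v, w, hT, hW⟩ := F.exists_distTriang_lamOn hAM X
      have hWK : F.obj K W.obj := (F.obj K).ext_of_isTriangulatedClosed₁ _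
        ((F.obj M).ι.map_distinguished _ hT) hX
        (F.monotone (hK ▸ le_sup_left) _ ((F.lam A).obj X.obj).property)
      subst hK
      have := F.isIso_quotientFunctor_map_of_distTriang₂ hT (hF.mem_of_leftOrthogonal hWK hW)
      exact ⟨_, ⟨F.mapObjIso hIJ hAM _ ≪≫ (asIso ((F.quotientFunctor J M).map v)).symm⟩⟩
    · rintro ⟨Y, ⟨e⟩⟩
      obtain ⟨Y, rfl⟩ := (F.sub I A).trW.Q_obj_surjective Y
      have e' := (F.map hJK (le_refl M)).mapIso ((F.mapObjIso hIJ hAM Y).symm ≪≫ e)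
      have hY : F.obj K Y.obj := F.monotone (hK ▸ le_sup_left) _ Y.property
      have hz := ((F.isZero_quotientFunctor_obj_iff hKM
        ((F.inclusion (le_refl M)).obj ((F.inclusion hAM).obj Y))).2 hY).of_iso
        (F.mapObjIso hJK (le_refl M) ((F.inclusion hAM).obj Y))
      exact (F.isZero_quotientFunctor_obj_iff hKM X).1
        (h.1 (hz.of_iso e'.symm))

end AdmissibleFiltration

/-! ### Join-primes in a finite distributive lattice. -/

section

variable {L : Type w} [DistribLattice L] [BoundedOrder L] [Finite L]

lemma le_of_forall_supPrime_le {a b : L} (h : ∀ r, SupPrime r → r ≤ a → r ≤ b) : a ≤ b := by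
  obtain ⟨S, rfl, hS⟩ := exists_supIrred_decomposition a
  exact Finset.sup_le fun r hr ↦ h r (supPrime_iff_supIrred.2 (hS hr)) (Finset.le_sup (f := id) hr)

lemma le_strictLower {r s : L} (hr : SupPrime r) (hrs : r < s) : r ≤ strictLower s :=
  Finset.le_sup (f := id) ((Set.Finite.mem_toFinset _).2 ⟨hr, hrs⟩)

lemma SupPrime.not_le_strictLower {s : L} (hs : SupPrime s) : ¬ s ≤ strictLower s := by
  intro h
  obtain ⟨r, hr, hsr⟩ := hs.le_finset_sup.1 h
  have hr' : SupPrime r ∧ r < s := by simpa using hr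
  exact absurd hsr (not_le_of_gt hr'.2)

lemma eq_of_le_of_not_le_strictLower {r s : L} (hr : SupPrime r) (hrs : r ≤ s)
    (h : ¬ r ≤ strictLower s) : r = s :=
  hrs.eq_or_lt.resolve_right fun hlt ↦ h (le_strictLower hr hlt)

lemma SupPrime.inf_eq_strictLower {s J : L} (hJ : ¬ s ≤ J) (hs : strictLower s ≤ J) :
    s ⊓ J = strictLower s := by
  refine le_antisymm (le_of_forall_supPrime_le fun r hr hrJ ↦ ?_) (le_inf (strictLower_le s) hs)
  refine le_strictLower hr ((hrJ.trans inf_le_left).lt_of_ne ?_)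
  rintro rfl
  exact hJ (hrJ.trans inf_le_right)

/-- Supplies the next step of a chain from `J` to `M`: a minimal join-prime below `M` but not below
`J` has all smaller join-primes below `J`. -/
lemma exists_supPrime_strictLower_le {J M : L} (h : ¬ M ≤ J) :
    ∃ s, SupPrime s ∧ s ≤ M ∧ ¬ s ≤ J ∧ strictLower s ≤ J := by
  obtain ⟨s, hs⟩ := (Set.toFinite {s : L | SupPrime s ∧ s ≤ M ∧ ¬ s ≤ J}).exists_minimal (by
    by_contra! he
    refine h (le_of_forall_supPrime_le fun r hr hrM ↦ ?_)
    by_contra hrJ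
    exact (he ▸ (⟨hr, hrM, hrJ⟩ : r ∈ {s : L | SupPrime s ∧ s ≤ M ∧ ¬ s ≤ J}) : r ∈ (∅ : Set L)))
  refine ⟨s, hs.prop.1, hs.prop.2.1, hs.prop.2.2, Finset.sup_le fun r hr ↦ ?_⟩
  have hr' : SupPrime r ∧ r < s := by simpa using hr
  by_contra hrJ
  exact absurd (hs.le_of_le ⟨hr'.1, hr'.2.le.trans hs.prop.2.1, hrJ⟩ hr'.2.le) (not_le_of_gt hr'.2)

end

/-! ### Construction and uniqueness of the system of t-structures. -/

namespace AdmissibleFiltration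

variable {L : Type w} [DistribLattice L] [BoundedOrder L]
  {C : Type u} [Category.{v} C] [Preadditive C] [HasZeroObject C] [HasShift C ℤ]
  [∀ n : ℤ, (shiftFunctor C n).Additive] [Pretriangulated C] [IsTriangulated C]
  {F : AdmissibleFiltration L C}

/-- A t-structure on `C_{A ⊔ J} / C_J` is determined by that on the equivalent category
`C_A / C_{A ⊓ J}`, if both belong to a system compatible with gluing. -/
lemma IsStrict.tStructure_sup_eq (hF : F.IsStrict)
    {t t' : ∀ J K : L, J ≤ K → TStructure (F.Subquotient J K)}
    (ht : ∀ (J K M : L) (hJK : J ≤ K) (hKM : K ≤ M),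
      IsGlued (F.map (le_refl J) hKM) (F.map hJK (le_refl M))
        (t J K hJK) (t J M (hJK.trans hKM)) (t K M hKM))
    (ht' : ∀ (J K M : L) (hJK : J ≤ K) (hKM : K ≤ M),
      IsGlued (F.map (le_refl J) hKM) (F.map hJK (le_refl M))
        (t' J K hJK) (t' J M (hJK.trans hKM)) (t' K M hKM))
    {A I J K : L} (hI : A ⊓ J = I) (hK : A ⊔ J = K) (hIA : I ≤ A) (hJK : J ≤ K)
    (h : t I A hIA = t' I A hIA) : t J K hJK = t' J K hJK := by
  have hIJ : I ≤ J := hI ▸ inf_le_right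
  have hAK : A ≤ K := hK ▸ le_sup_left
  let e := F.map hIJ hAK
  have : e.IsTriangulated := F.isTriangulated_map hIJ hAK
  have : e.Faithful := (hF.fullyFaithfulMap hI hIJ hAK).faithful
  -- Essential surjectivity: the third term of the recollement is `C_K / C_K = 0`.
  have he (Y : F.Subquotient J K) : ∃ X, Nonempty (e.obj X ≅ Y) := by
    refine ((hF.isRecollement hI hK hIJ hJK hAK le_rfl).isZero_obj_iff Y).1 ?_
    obtain ⟨Z, hZ⟩ := (F.sub K K).trW.Q_obj_surjective ((F.map hJK (le_refl K)).obj Y)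
    rw [← hZ]
    exact (F.isZero_quotientFunctor_obj_iff le_rfl Z).2 Z.property
  -- `e` factors as `C_A / C_I ⥤ C_K / C_I ⥤ C_K / C_J`. Gluing for `I ≤ A ≤ K` and for `I ≤ J ≤ K`
  -- makes the two factors t-exact, whatever the system.
  have iso (X : F.Subquotient I A) :
      Nonempty ((F.map hIJ (le_refl K)).obj ((F.map (le_refl I) hAK).obj X) ≅ e.obj X) := by
    obtain ⟨X, rfl⟩ := (F.sub I A).trW.Q_obj_surjective X
    exact ⟨(F.map hIJ (le_refl K)).mapIso (F.mapObjIso (le_refl I) hAK X) ≪≫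
      F.mapObjIso hIJ (le_refl K) _ ≪≫ (F.mapObjIso hIJ hAK X).symm⟩
  have hle {t : ∀ J K : L, J ≤ K → TStructure (F.Subquotient J K)}
      (ht : ∀ (J K M : L) (hJK : J ≤ K) (hKM : K ≤ M),
        IsGlued (F.map (le_refl J) hKM) (F.map hJK (le_refl M))
          (t J K hJK) (t J M (hJK.trans hKM)) (t K M hKM)) (X : F.Subquotient I A)
      (hX : (t I A hIA).le 0 X) : (t J K hJK).le 0 (e.obj X) :=
    ((t J K hJK).le 0).prop_of_iso (iso X).some
      ((ht I J K hIJ hJK).le_zero_j_obj ((ht I A K hIA hAK).le_zero_i_obj hX))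
  have hge {t : ∀ J K : L, J ≤ K → TStructure (F.Subquotient J K)}
      (ht : ∀ (J K M : L) (hJK : J ≤ K) (hKM : K ≤ M),
        IsGlued (F.map (le_refl J) hKM) (F.map hJK (le_refl M))
          (t J K hJK) (t J M (hJK.trans hKM)) (t K M hKM)) (X : F.Subquotient I A)
      (hX : (t I A hIA).ge 1 X) : (t J K hJK).ge 1 (e.obj X) :=
    ((t J K hJK).ge 1).prop_of_iso (iso X).some
      ((ht I J K hIJ hJK).ge_one_j_obj ((ht I A K hIA hAK).ge_one_i_obj hX))
  refine TStructure.ext_of_le_of_ge (fun Y ↦ ?_) (fun Y ↦ ?_)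
  · obtain ⟨X, ⟨f⟩⟩ := he Y
    rw [← ((t J K hJK).le 0).prop_iff_of_iso f, ← ((t' J K hJK).le 0).prop_iff_of_iso f,
      TStructure.le_zero_obj_iff e _ _ (hle ht) (hge ht),
      TStructure.le_zero_obj_iff e _ _ (hle ht') (hge ht'), h]
  · obtain ⟨X, ⟨f⟩⟩ := he Y
    rw [← ((t J K hJK).ge 1).prop_iff_of_iso f, ← ((t' J K hJK).ge 1).prop_iff_of_iso f,
      TStructure.ge_one_obj_iff e _ _ (hle ht) (hge ht),
      TStructure.ge_one_obj_iff e _ _ (hle ht') (hge ht'), h]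

variable [Finite L]

/-- The t-structures on the subquotients `C_s / C_{s_<}` glue to a t-structure on `C_M / C_J` which
is described by the images in these subquotients of the (co)reflections onto the `C_s`. -/
lemma IsStrict.exists_tStructure (hF : F.IsStrict)
    (t₀ : ∀ s : L, SupPrime s → TStructure (F.Subquotient (strictLower s) s)) (M J : L)
    (hJM : J ≤ M) :
    ∃ t : TStructure (F.Subquotient J M), ∀ (n : ℤ) (X : (F.obj M).FullSubcategory),
      (t.le n ((F.quotientFunctor J M).obj X) ↔ ∀ (s : L) (hs : SupPrime s), s ≤ M → ¬ s ≤ J →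
        (t₀ s hs).le n ((F.quotientFunctor (strictLower s) s).obj ((F.lam s).obj X.obj))) ∧
      (t.ge n ((F.quotientFunctor J M).obj X) ↔ ∀ (s : L) (hs : SupPrime s), s ≤ M → ¬ s ≤ J →
        (t₀ s hs).ge n ((F.quotientFunctor (strictLower s) s).obj ((F.rho s).obj X.obj))) := by
  induction J using WellFoundedGT.induction with
  | ind J ih =>
  by_cases hMJ : M ≤ J
  · refine ⟨.ofIsZero fun X ↦ ?_, fun n X ↦ ⟨?_, ?_⟩⟩
    · obtain ⟨X, rfl⟩ := (F.sub J M).trW.Q_obj_surjective X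
      exact (F.isZero_quotientFunctor_obj_iff hJM X).2 (F.monotone hMJ _ X.property)
    · exact ⟨fun _ s _ hsM hsJ ↦ (hsJ (hsM.trans hMJ)).elim, fun _ ↦ trivial⟩
    · exact ⟨fun _ s _ hsM hsJ ↦ (hsJ (hsM.trans hMJ)).elim, fun _ ↦ trivial⟩
  obtain ⟨s, hs, hsM, hsJ, hJ⟩ := exists_supPrime_strictLower_le hMJ
  have hI := SupPrime.inf_eq_strictLower hsJ hJ
  have hKM : s ⊔ J ≤ M := sup_le hsM hJM
  have hlt : J < s ⊔ J := lt_of_le_of_ne le_sup_right fun h ↦ hsJ (h ▸ le_sup_left)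
  obtain ⟨t₁, ht₁⟩ := ih (s ⊔ J) hlt hKM
  obtain ⟨t, ht⟩ := (hF.isRecollement hI rfl hJ le_sup_right hsM hKM).exists_tStructure
    (t₀ s hs) t₁ (hF.lamMapAdj hI hJ hsM) (hF.rhoMapAdj hI hJ hsM)
  -- Replacing `J` by `s ⊔ J` removes exactly `s` from the join-primes indexing the description.
  have key (r : L) (hr : SupPrime r) (hrJ : ¬ r ≤ J) (hrs : r ≠ s) : ¬ r ≤ s ⊔ J := fun h ↦
    (hr.2 h).elim (fun h ↦ hrJ ((le_strictLower hr (h.lt_of_ne hrs)).trans hJ)) hrJ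
  refine ⟨t, fun n X ↦ ⟨?_, ?_⟩⟩
  · rw [(ht n _).1, ((t₀ s hs).le n).prop_iff_of_iso (hF.lamMapObjIso hI X),
      (t₁.le n).prop_iff_of_iso (F.mapObjIso le_sup_right (le_refl M) X), (ht₁ n _).1]
    constructor
    · rintro ⟨h, h'⟩ r hr hrM hrJ
      by_cases hrs : r = s
      · subst hrs
        exact h
      · exact h' r hr hrM (key r hr hrJ hrs)
    · exact fun h ↦ ⟨h s hs hsM hsJ, fun r hr hrM hrJ ↦ h r hr hrM (fun h' ↦
        hrJ (h'.trans le_sup_right))⟩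
  · rw [(ht n _).2, ((t₀ s hs).ge n).prop_iff_of_iso (hF.rhoMapObjIso hI X),
      (t₁.ge n).prop_iff_of_iso (F.mapObjIso le_sup_right (le_refl M) X), (ht₁ n _).2]
    constructor
    · rintro ⟨h, h'⟩ r hr hrM hrJ
      by_cases hrs : r = s
      · subst hrs
        exact h
      · exact h' r hr hrM (key r hr hrJ hrs)
    · exact fun h ↦ ⟨h s hs hsM hsJ, fun r hr hrM hrJ ↦ h r hr hrM (fun h' ↦
        hrJ (h'.trans le_sup_right))⟩

/-- A system of t-structures which is compatible with gluing is determined by the t-structures on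
the categories `C_s / C_{s_<}`. -/
lemma IsStrict.tStructure_unique (hF : F.IsStrict)
    {t t' : ∀ J K : L, J ≤ K → TStructure (F.Subquotient J K)}
    (ht : ∀ (J K M : L) (hJK : J ≤ K) (hKM : K ≤ M),
      IsGlued (F.map (le_refl J) hKM) (F.map hJK (le_refl M))
        (t J K hJK) (t J M (hJK.trans hKM)) (t K M hKM))
    (ht' : ∀ (J K M : L) (hJK : J ≤ K) (hKM : K ≤ M),
      IsGlued (F.map (le_refl J) hKM) (F.map hJK (le_refl M))
        (t' J K hJK) (t' J M (hJK.trans hKM)) (t' K M hKM))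
    (h : ∀ s : L, SupPrime s →
      t (strictLower s) s (strictLower_le s) = t' (strictLower s) s (strictLower_le s))
    (M J : L) (hJM : J ≤ M) : t J M hJM = t' J M hJM := by
  induction J using WellFoundedGT.induction with
  | ind J ih =>
  by_cases hMJ : M ≤ J
  · refine TStructure.ext_of_le_of_ge (fun X ↦ ?_) (fun X ↦ ?_) <;>
    · have hX : IsZero X := by
        obtain ⟨X, rfl⟩ := (F.sub J M).trW.Q_obj_surjective X
        exact (F.isZero_quotientFunctor_obj_iff hJM X).2 (F.monotone hMJ _ X.property)
      simp [TStructure.isLE_of_isZero, TStructure.isGE_of_isZero, hX]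
  obtain ⟨s, hs, hsM, hsJ, hJ⟩ := exists_supPrime_strictLower_le hMJ
  have hKM : s ⊔ J ≤ M := sup_le hsM hJM
  have hlt : J < s ⊔ J := lt_of_le_of_ne le_sup_right fun h ↦ hsJ (h ▸ le_sup_left)
  have h₀ := hF.tStructure_sup_eq ht ht' (SupPrime.inf_eq_strictLower hsJ hJ) rfl
    (strictLower_le s) le_sup_right (h s hs)
  have h₁ := ih (s ⊔ J) hlt hKM
  have g := ht J (s ⊔ J) M le_sup_right hKM
  rw [h₀, h₁] at g
  exact g.unique (ht' J (s ⊔ J) M le_sup_right hKM)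

end AdmissibleFiltration

theorem mainTheorem4 {L : Type w} [DistribLattice L] [BoundedOrder L] [Finite L]
    {C : Type u} [Category.{v} C] [Preadditive C] [HasZeroObject C] [HasShift C ℤ]
    [∀ n : ℤ, (shiftFunctor C n).Additive] [Pretriangulated C] [IsTriangulated C]
    (F : AdmissibleFiltration L C) (hF : F.IsStrict)
    (t₀ : ∀ s : L, SupPrime s → TStructure (F.Subquotient (strictLower s) s)) :
    ∃! t : ∀ J K : L, J ≤ K → TStructure (F.Subquotient J K),
      (∀ (s : L) (hs : SupPrime s), t (strictLower s) s (strictLower_le s) = t₀ s hs) ∧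
      ∀ (J K M : L) (hJK : J ≤ K) (hKM : K ≤ M),
        IsGlued (F.map (le_refl J) hKM) (F.map hJK (le_refl M))
          (t J K hJK) (t J M (hJK.trans hKM)) (t K M hKM) := by
  choose t ht using fun J M ↦ hF.exists_tStructure t₀ M J
  have h₁ (s : L) (hs : SupPrime s) : t (strictLower s) s (strictLower_le s) = t₀ s hs := by
    refine TStructure.ext_of_le_of_ge (fun X ↦ ?_) (fun X ↦ ?_)
    · obtain ⟨X, rfl⟩ := (F.sub (strictLower s) s).trW.Q_obj_surjective X
      have e := (F.quotientFunctor (strictLower s) s).mapIso (F.lamObjIso X.property)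
      rw [(ht _ _ _ 0 X).1]
      refine ⟨fun h ↦ ((t₀ s hs).le 0).prop_of_iso e (h s hs le_rfl hs.not_le_strictLower),
        fun h r hr hrs hn ↦ ?_⟩
      -- For the pair `s_< ≤ s` the only index is `s` itself, and `lam s` is the identity on `C_s`.
      obtain rfl := eq_of_le_of_not_le_strictLower hr hrs hn
      exact ((t₀ r hs).le 0).prop_of_iso e.symm h
    · obtain ⟨X, rfl⟩ := (F.sub (strictLower s) s).trW.Q_obj_surjective X
      have e := (F.quotientFunctor (strictLower s) s).mapIso (F.rhoObjIso X.property)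
      rw [(ht _ _ _ 1 X).2]
      refine ⟨fun h ↦ ((t₀ s hs).ge 1).prop_of_iso e.symm (h s hs le_rfl hs.not_le_strictLower),
        fun h r hr hrs hn ↦ ?_⟩
      obtain rfl := eq_of_le_of_not_le_strictLower hr hrs hn
      exact ((t₀ r hs).ge 1).prop_of_iso e h
  have h₂ (J K M : L) (hJK : J ≤ K) (hKM : K ≤ M) :
      IsGlued (F.map (le_refl J) hKM) (F.map hJK (le_refl M))
        (t J K hJK) (t J M (hJK.trans hKM)) (t K M hKM) := by
    have hI : K ⊓ J = J := inf_eq_right.2 hJK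
    refine ⟨hF.isRecollement hI (sup_eq_left.2 hJK) (le_refl J) hJK hKM hKM,
      fun iL adj X ↦ ?_, fun iR adj X ↦ ?_⟩
    · obtain ⟨X, rfl⟩ := (F.sub J M).trW.Q_obj_surjective X
      -- The left adjoint in the gluing condition is arbitrary; uniqueness of adjoints replaces it
      -- by the functor induced by `lam K`.
      let e := (adj.leftAdjointUniq (hF.lamMapAdj hI (le_refl J) hKM)).app _ ≪≫
        hF.lamMapObjIso hI X
      rw [((t J K hJK).le 0).prop_iff_of_iso e,
        ((t K M hKM).le 0).prop_iff_of_iso (F.mapObjIso hJK (le_refl M) X),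
        (ht _ _ _ 0 _).1, (ht _ _ _ 0 _).1, (ht _ _ _ 0 _).1]
      have e' (s : L) (hsK : s ≤ K) :
          (F.quotientFunctor (strictLower s) s).obj ((F.lam s).obj X.obj) ≅
            (F.quotientFunctor (strictLower s) s).obj
              ((F.lam s).obj ((F.lam K).obj X.obj).obj) :=
        have := F.isIso_lam_map_toLam hsK X.obj
        (F.quotientFunctor (strictLower s) s).mapIso
          (asIso ((F.lam s).map (F.toLam K X.obj)))
      -- The join-primes below `M` and not below `J` split into those below `K`, seen by `i^*`, and
      -- those not below `K`, seen by `j^*`.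
      refine ⟨fun h ↦ ⟨fun s hs hsK hsJ ↦ ?_, fun s hs hsM hsK ↦ ?_⟩, fun h s hs hsM hsJ ↦ ?_⟩
      · exact ((t₀ s hs).le 0).prop_of_iso (e' s hsK) (h s hs (hsK.trans hKM) hsJ)
      · exact h s hs hsM fun hsJ ↦ hsK (hsJ.trans hJK)
      · by_cases hsK : s ≤ K
        · exact ((t₀ s hs).le 0).prop_of_iso (e' s hsK).symm (h.1 s hs hsK hsJ)
        · exact h.2 s hs hsM hsK
    · obtain ⟨X, rfl⟩ := (F.sub J M).trW.Q_obj_surjective X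
      let e := (adj.rightAdjointUniq (hF.rhoMapAdj hI (le_refl J) hKM)).app _ ≪≫
        hF.rhoMapObjIso hI X
      rw [((t J K hJK).ge 1).prop_iff_of_iso e,
        ((t K M hKM).ge 1).prop_iff_of_iso (F.mapObjIso hJK (le_refl M) X),
        (ht _ _ _ 1 _).2, (ht _ _ _ 1 _).2, (ht _ _ _ 1 _).2]
      have e' (s : L) (hsK : s ≤ K) :
          (F.quotientFunctor (strictLower s) s).obj
              ((F.rho s).obj ((F.rho K).obj X.obj).obj) ≅
            (F.quotientFunctor (strictLower s) s).obj ((F.rho s).obj X.obj) :=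
        have := F.isIso_rho_map_fromRho hsK X.obj
        (F.quotientFunctor (strictLower s) s).mapIso
          (asIso ((F.rho s).map (F.fromRho K X.obj)))
      refine ⟨fun h ↦ ⟨fun s hs hsK hsJ ↦ ?_, fun s hs hsM hsK ↦ ?_⟩, fun h s hs hsM hsJ ↦ ?_⟩
      · exact ((t₀ s hs).ge 1).prop_of_iso (e' s hsK).symm (h s hs (hsK.trans hKM) hsJ)
      · exact h s hs hsM fun hsJ ↦ hsK (hsJ.trans hJK)
      · by_cases hsK : s ≤ K
        · exact ((t₀ s hs).ge 1).prop_of_iso (e' s hsK) (h.1 s hs hsK hsJ)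
        · exact h.2 s hs hsM hsK
  refine ⟨t, ⟨h₁, h₂⟩, fun t' ht' ↦ ?_⟩
  funext J M hJM
  exact hF.tStructure_unique ht'.2 h₂ (fun s hs ↦ (ht'.1 s hs).trans (h₁ s hs).symm) M J hJM
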